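/- Let $\Omega=(a,b)\times(c,d)$ with $a<b$, $c<d$, let $T>0$ and $0<\gamma<1$. Let $u$ be a solution of $$\frac{\partial u}{\partial t}(x,y,t)+\int_\Omega\frac{u(x,y,t)-u(\bar x,\bar y,t)}{|x-\bar x|^{\gamma}|y-\bar y|^{\gamma}}\,d\bar x\,d\bar y=f(x,y,t),\qquad (x,y,t)\in\Omega\times(0,T],$$ with $u=g$ on $\partial\Omega\times(0,T]$ and $u(\cdot,\cdot,0)=u_0$ in $\Omega$. Assume that $u(\cdot,\cdot,t)\in C^6([a,b]\times[c,d])$ with derivatives of order $\le 6$ bounded uniformly in $t\in[0,T]$, and $u(x,y,\cdot)\in C^3([0,T])$ with derivatives of order $\le 3$ bounded uniformly in $(x,y)\in[a,b]\times[c,d]$. For integers $M_x,M_y\ge1$ put $h_x=(b-a)/M_x$, $h_y=(d-c)/M_y$, $x_{i/2}=a+\tfrac i2h_x$ $(0\le i\le 2M_x)$, $y_{j/2}=c+\tfrac j2h_y$ $(0\le j\le 2M_y)$. Let $\phi_{l/2}$, $0\le l\le 2M_x$, be the continuous piecewise quadratic Lagrange basis on the cells $[x_{l-1},x_l]$, $1\le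 l\le M_x$, with nodes $x_{l/2}$ (so $\phi_{l/2}(x_{i/2})=\delta_{il}$); for the $y$-direction, also written $\phi_{r/2}$, likewise. For $1\le i\le 2M_x-1$ put $$d^x_i=\int_a^b\frac{d\bar x}{|x_{i/2}-\bar x|^\gamma},\qquad g^x_{i,l}=\int_a^b\frac{\phi_{l/2}(\bar x)}{|x_{i/2}-\bar x|^\gamma}\,d\bar x\quad(0\le l\le 2M_x),$$ and define $d^y_j,g^y_{j,r}$ in the same way on $[c,d]$. Let $\mathcal A=\mathcal D_x\otimes\mathcal D_y-\mathcal G_x\otimes\mathcal G_y$ with $\mathcal D_x=\mathrm{diag}(d^x_i)_{1\le i\le 2M_x-1}$, $\mathcal G_x=(g^x_{i,l})_{1\le i,l\le 2M_x-1}$, and similarly $\mathcal D_y,\mathcal G_y$. Let $\tau>0$, $N\ge0$ with $N\tau\le T$, $t_s=s\tau$. The Crank–Nicolson scheme is $$\Big(I+\frac\tau2\mathcal A\Big)U^k=\Big(I-\frac\tau2\mathcal A\Big)U^{k-1}+\tau F^{k-\frac12}+\tau K^{k-\frac12},\quad k=1,\dots,N,$$ for $U^k=(u^k_{i/2,j/2})_{1\le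 i\le 2M_x-1,\,1\le j\le 2M_y-1}$, with $u^0_{i/2,j/2}=u_0(x_{i/2},y_{j/2})$, $F^{k-1/2}_{i,j}=f(x_{i/2},y_{j/2},t_{k-1/2})$, and boundary data $$K^{k-\frac12}_{i,j}=\sum_{(l,r)}g^x_{i,l}\,g^y_{j,r}\,g(x_{l/2},y_{r/2},t_{k-\frac12}),$$ the sum being over all $0\le l\le 2M_x$, $0\le r\le 2M_y$ with $(x_{l/2},y_{r/2})\in\partial\Omega$. Then there is a constant $C$, independent of $M_x,M_y,N,\tau$, such that for all $M_x,M_y\ge 1$ and all $\tau>0$, $N\ge0$ with $N\tau\le T$ the scheme has a unique solution, and this solution satisfies $$\max_{1\le i\le 2M_x-1,\;1\le j\le 2M_y-1}\big|u(x_{i/2},y_{j/2},t_k)-u^k_{i/2,j/2}\big|\le C\big(\tau^2+h_x^{4-\gamma}+h_y^{4-\gamma}\big),\qquad k=0,1,\dots,N.$$ -/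

import Mathlib

open Set MeasureTheory
open scoped Kronecker

namespace NonlocalCN

/-- The step size `(b - a) / M` of the uniform partition of `[a, b]` into `M` cells. -/
noncomputable def step (a b : ℝ) (M : ℕ) : ℝ := (b - a) / M

/-- The point `x_s = a + s h`; it is used for integers and half-integers `s`. -/
noncomputable def node (a h s : ℝ) : ℝ := a + s * h

/-- The quadratic basis function attached to the cell end point `x_l` (`l` an integer). For `l = 0`
and `l = M`, only one of the two branches matters on `[a, b]`. -/
noncomputable def vertexBasis (a h l x : ℝ) : ℝ :=
  if node a h (l - 1) ≤ x ∧ x ≤ node a h l then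
    (x - node a h (l - 1)) / h * ((2 * x - (node a h l + node a h (l - 1))) / h)
  else if node a h l ≤ x ∧ x ≤ node a h (l + 1) then
    (node a h (l + 1) - x) / h * (((node a h (l + 1) + node a h l) - 2 * x) / h)
  else 0

/-- The quadratic basis function attached to the cell midpoint `x_s`, `s = l - 1/2`, of the cell
`[x_{l-1}, x_l] = [x_{s-1/2}, x_{s+1/2}]`. -/
noncomputable def midBasis (a h s x : ℝ) : ℝ :=
  if node a h (s - 1 / 2) ≤ x ∧ x ≤ node a h (s + 1 / 2) then
    4 * (x - node a h (s - 1 / 2)) * (node a h (s + 1 / 2) - x) / h ^ 2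
  else 0

/-- The basis function `φ_{i/2}`, `0 ≤ i ≤ 2M`. -/
noncomputable def basis (a h : ℝ) (i : ℕ) (x : ℝ) : ℝ :=
  if Even i then vertexBasis a h ((i : ℝ) / 2) x else midBasis a h ((i : ℝ) / 2) x

/-- `∫_a^b |x_{i/2} - x|^{-γ} dx`. -/
noncomputable def diagWeight (a b γ : ℝ) (M i : ℕ) : ℝ :=
  ∫ x in a..b, 1 / |node a (step a b M) ((i : ℝ) / 2) - x| ^ γ

/-- `∫_a^b φ_{l/2}(x) |x_{i/2} - x|^{-γ} dx`. -/
noncomputable def weight (a b γ : ℝ) (M i l : ℕ) : ℝ :=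
  ∫ x in a..b, basis a (step a b M) l x / |node a (step a b M) ((i : ℝ) / 2) - x| ^ γ

/-- The diagonal matrix `𝒟` of one space direction. The interior nodes `x_{i/2}`,
`i = 1, …, 2M - 1`, are indexed by `Fin (2 * M - 1)`, with `i` at position `i - 1`. -/
noncomputable def matD (a b γ : ℝ) (M : ℕ) : Matrix (Fin (2 * M - 1)) (Fin (2 * M - 1)) ℝ :=
  Matrix.diagonal fun i => diagWeight a b γ M ((i : ℕ) + 1)

/-- The matrix `𝒢` of one space direction. -/
noncomputable def matG (a b γ : ℝ) (M : ℕ) : Matrix (Fin (2 * M - 1)) (Fin (2 * M - 1)) ℝ :=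
  Matrix.of fun i l => weight a b γ M ((i : ℕ) + 1) ((l : ℕ) + 1)

/-- The indices of the interior nodes of the two-dimensional grid. -/
abbrev Grid (Mx My : ℕ) : Type := Fin (2 * Mx - 1) × Fin (2 * My - 1)

/-- `𝒜 = 𝒟_x ⊗ 𝒟_y - 𝒢_x ⊗ 𝒢_y`. -/
noncomputable def matA (a b c d γ : ℝ) (Mx My : ℕ) : Matrix (Grid Mx My) (Grid Mx My) ℝ :=
  matD a b γ Mx ⊗ₖ matD c d γ My - matG a b γ Mx ⊗ₖ matG c d γ My

/-- The values `v(x_{i/2}, y_{j/2})` of a function of two variables at the interior nodes. -/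
noncomputable def sample (a b c d : ℝ) (Mx My : ℕ) (v : ℝ → ℝ → ℝ) : Grid Mx My → ℝ := fun p =>
  v (node a (step a b Mx) ((((p.1 : ℕ) + 1 : ℕ) : ℝ) / 2))
    (node c (step c d My) ((((p.2 : ℕ) + 1 : ℕ) : ℝ) / 2))

/-- The boundary vector `K`, for boundary values given by `g`. -/
noncomputable def bdryVec (a b c d γ : ℝ) (Mx My : ℕ) (g : ℝ → ℝ → ℝ) : Grid Mx My → ℝ := fun p =>
  let X : ℕ → ℝ := fun l => node a (step a b Mx) ((l : ℝ) / 2)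
  let Y : ℕ → ℝ := fun r => node c (step c d My) ((r : ℝ) / 2)
  let wx : ℕ → ℝ := fun l => weight a b γ Mx ((p.1 : ℕ) + 1) l
  let wy : ℕ → ℝ := fun r => weight c d γ My ((p.2 : ℕ) + 1) r
  wx 0 * ∑ r ∈ Finset.Icc 0 (2 * My), wy r * g (X 0) (Y r)
    + wx (2 * Mx) * ∑ r ∈ Finset.Icc 0 (2 * My), wy r * g (X (2 * Mx)) (Y r)
    + ∑ l ∈ Finset.Icc 1 (2 * Mx - 1), wx l * wy 0 * g (X l) (Y 0)
    + ∑ l ∈ Finset.Icc 1 (2 * Mx - 1), wx l * wy (2 * My) * g (X l) (Y (2 * My))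

/-- `U 0, …, U N` solve the Crank–Nicolson collocation scheme with time step `τ`, source `f`,
boundary values `g` and initial values `u₀`. The step from `U k` to `U (k + 1)` takes the source and
the boundary values at time `t_{k+1/2} = (k + 1/2) τ`. -/
def IsSchemeSolution (a b c d γ τ : ℝ) (Mx My N : ℕ) (f g : ℝ → ℝ → ℝ → ℝ) (u₀ : ℝ → ℝ → ℝ)
    (U : Fin (N + 1) → Grid Mx My → ℝ) : Prop :=
  U 0 = sample a b c d Mx My u₀ ∧
  ∀ k : Fin N,
    (1 + (τ / 2) • matA a b c d γ Mx My).mulVec (U k.succ) =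
      (1 - (τ / 2) • matA a b c d γ Mx My).mulVec (U k.castSucc)
        + τ • sample a b c d Mx My (fun x y => f x y ((((k : ℕ) : ℝ) + 1 / 2) * τ))
        + τ • bdryVec a b c d γ Mx My (fun x y => g x y ((((k : ℕ) : ℝ) + 1 / 2) * τ))

/-- The nonlocal operator with kernel `|x - x̄|^{-γ} |y - ȳ|^{-γ}` on `(a, b) × (c, d)`. -/
noncomputable def nonlocalOp (a b c d γ : ℝ) (v : ℝ → ℝ → ℝ) (x y : ℝ) : ℝ :=
  ∫ p in Ioo a b ×ˢ Ioo c d, (v x y - v p.1 p.2) / (|x - p.1| ^ γ * |y - p.2| ^ γ)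

/-- `u` solves `∂ₜu + (nonlocal operator) u = f` in `Ω × (0, T]`, `Ω = (a, b) × (c, d)`, with
Dirichlet boundary values `g` and initial values `u₀`. The time derivative at `t = T` is one-sided. -/
def IsExactSolution (a b c d T γ : ℝ) (f g : ℝ → ℝ → ℝ → ℝ) (u₀ : ℝ → ℝ → ℝ)
    (u : ℝ → ℝ → ℝ → ℝ) : Prop :=
  (∀ x ∈ Ioo a b, ∀ y ∈ Ioo c d, ∀ t ∈ Ioc 0 T,
    HasDerivWithinAt (fun s => u x y s)
      (f x y t - nonlocalOp a b c d γ (fun x' y' => u x' y' t) x y) (Icc 0 T) t) ∧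
  (∀ p ∈ (Icc a b ×ˢ Icc c d) \ (Ioo a b ×ˢ Ioo c d), ∀ t ∈ Ioc 0 T,
    u p.1 p.2 t = g p.1 p.2 t) ∧
  (∀ x ∈ Ioo a b, ∀ y ∈ Ioo c d, u x y 0 = u₀ x y)

/-- `u(·, ·, t) ∈ C⁶([a, b] × [c, d])` with derivatives of order at most six bounded uniformly in
`t ∈ [0, T]`, and `u(x, y, ·) ∈ C³([0, T])` with derivatives of order at most three bounded
uniformly in `(x, y) ∈ [a, b] × [c, d]`. -/
def IsSmooth (a b c d T : ℝ) (u : ℝ → ℝ → ℝ → ℝ) : Prop :=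
  (∀ t ∈ Icc 0 T, ContDiffOn ℝ 6 (fun p : ℝ × ℝ => u p.1 p.2 t) (Icc a b ×ˢ Icc c d)) ∧
  (∃ B : ℝ, ∀ t ∈ Icc 0 T, ∀ p ∈ Icc a b ×ˢ Icc c d, ∀ m : ℕ, m ≤ 6 →
    ‖iteratedFDerivWithin ℝ m (fun q : ℝ × ℝ => u q.1 q.2 t) (Icc a b ×ˢ Icc c d) p‖ ≤ B) ∧
  (∀ p ∈ Icc a b ×ˢ Icc c d, ContDiffOn ℝ 3 (fun t => u p.1 p.2 t) (Icc 0 T)) ∧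
  (∃ B : ℝ, ∀ p ∈ Icc a b ×ˢ Icc c d, ∀ t ∈ Icc 0 T, ∀ m : ℕ, m ≤ 3 →
    |iteratedDerivWithin m (fun s => u p.1 p.2 s) (Icc 0 T) t| ≤ B)

end NonlocalCN

namespace NonlocalCN

/-!
On a cell the error of quadratic interpolation is a multiple of the nodal cubic plus a term of
fourth order. The nodal cubic is odd about the midpoint of the cell, so when it is integrated
against the kernel `|x - ·|^(-γ)` only the difference of the kernel masses of the two half cells
contributes. At a grid node these differences telescope over the cells on either side of the node,
and the total is of order `h^(1-γ)` instead of `1`: this is the gain from `h^3` to `h^(4-γ)`.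

The quadrature weights are nonnegative and each row sums to at most the diagonal entry, so `𝒜` is
weakly row diagonally dominant with nonnegative diagonal. Hence `I + τ/2 𝒜` is invertible, with an
inverse of norm at most `1` in the maximum norm. The Crank–Nicolson step is of second order by
Taylor expansion at the midpoint, and a discrete Grönwall inequality adds up the local errors.
-/

section IntervalIntegral

lemma integral_eq_zero_of_odd {f : ℝ → ℝ} {p q : ℝ} (hf : ∀ x, f (p + q - x) = -f x) :
    ∫ x in p..q, f x = 0 := by
  have hreflect := intervalIntegral.integral_comp_sub_left (a := p) (b := q) f (p + q)
  simp only [hf, add_sub_cancel_right, add_sub_cancel_left, intervalIntegral.integral_neg]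
    at hreflect
  linarith

lemma abs_integral_le_of_abs_le {f g : ℝ → ℝ} {p q : ℝ} (hpq : p ≤ q)
    (hg : IntervalIntegrable g volume p q) (hfg : ∀ x ∈ Ioo p q, |f x| ≤ g x) :
    |∫ x in p..q, f x| ≤ ∫ x in p..q, g x := by
  rw [← Real.norm_eq_abs]
  refine intervalIntegral.norm_integral_le_of_norm_le hpq ?_ hg
  filter_upwards [Measure.ae_ne volume q] with x hxq hx
  exact hfg x ⟨hx.1, lt_of_le_of_ne hx.2 hxq⟩

-- Since `w` has mean zero, the value of `k` at the midpoint may be subtracted from `k`; the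
-- difference then has a constant sign on each half of the interval.
lemma abs_integral_mul_le_of_antitoneOn {w k : ℝ → ℝ} {p h C : ℝ} (hh : 0 < h)
    (hw : Continuous w) (hw₀ : ∫ x in p..p + h, w x = 0) (hC : ∀ x ∈ Icc p (p + h), |w x| ≤ C)
    (hk : ∀ s t, IntervalIntegrable k volume s t) (hanti : AntitoneOn k (Ioo p (p + h))) :
    |∫ x in p..p + h, w x * k x| ≤
      C * ((∫ x in p..p + h / 2, k x) - ∫ x in p + h / 2..p + h, k x) := by
  set km := k (p + h / 2)
  have hmid : p + h / 2 ∈ Ioo p (p + h) := ⟨by linarith, by linarith⟩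
  have hdiff (s t) : IntervalIntegrable (fun x => k x - km) volume s t :=
    (hk s t).sub intervalIntegrable_const
  have hprod (s t) : IntervalIntegrable (fun x => w x * (k x - km)) volume s t :=
    (hdiff s t).continuousOn_mul hw.continuousOn
  have hsubtract : ∫ x in p..p + h, w x * k x = ∫ x in p..p + h, w x * (k x - km) := by
    simp only [mul_sub]
    rw [intervalIntegral.integral_sub ((hk _ _).continuousOn_mul hw.continuousOn)
      ((hw.intervalIntegrable _ _).mul_const _), intervalIntegral.integral_mul_const, hw₀,
      zero_mul, sub_zero]
  have hleft : |∫ x in p..p + h / 2, w x * (k x - km)| ≤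
      ∫ x in p..p + h / 2, C * (k x - km) := by
    refine abs_integral_le_of_abs_le (by linarith) ((hdiff _ _).const_mul _) fun x hx => ?_
    have hx' : x ∈ Ioo p (p + h) := ⟨hx.1, hx.2.trans hmid.2⟩
    have hkx : 0 ≤ k x - km := sub_nonneg.2 (hanti hx' hmid hx.2.le)
    rw [abs_mul, abs_of_nonneg hkx]
    exact mul_le_mul_of_nonneg_right (hC x (Ioo_subset_Icc_self hx')) hkx
  have hright : |∫ x in p + h / 2..p + h, w x * (k x - km)| ≤
      ∫ x in p + h / 2..p + h, C * -(k x - km) := by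
    refine abs_integral_le_of_abs_le (by linarith) ((hdiff _ _).neg.const_mul _) fun x hx => ?_
    have hx' : x ∈ Ioo p (p + h) := ⟨hmid.1.trans hx.1, hx.2⟩
    have hkx : k x - km ≤ 0 := sub_nonpos.2 (hanti hmid hx' hx.1.le)
    rw [abs_mul, abs_of_nonpos hkx]
    exact mul_le_mul_of_nonneg_right (hC x (Ioo_subset_Icc_self hx')) (neg_nonneg.2 hkx)
  rw [hsubtract, ← intervalIntegral.integral_add_adjacent_intervals (hprod p (p + h / 2))
    (hprod (p + h / 2) (p + h))]
  refine (abs_add_le _ _).trans ((add_le_add hleft hright).trans_eq ?_)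
  simp only [intervalIntegral.integral_const_mul, intervalIntegral.integral_neg,
    intervalIntegral.integral_sub (hk _ _) intervalIntegrable_const,
    intervalIntegral.integral_const, smul_eq_mul]
  ring

lemma abs_integral_mul_le_of_monotoneOn {w k : ℝ → ℝ} {p h C : ℝ} (hh : 0 < h)
    (hw : Continuous w) (hw₀ : ∫ x in p..p + h, w x = 0) (hC : ∀ x ∈ Icc p (p + h), |w x| ≤ C)
    (hk : ∀ s t, IntervalIntegrable k volume s t) (hmono : MonotoneOn k (Ioo p (p + h))) :
    |∫ x in p..p + h, w x * k x| ≤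
      C * ((∫ x in p + h / 2..p + h, k x) - ∫ x in p..p + h / 2, k x) := by
  have hneg := abs_integral_mul_le_of_antitoneOn hh hw hw₀ hC (fun s t => (hk s t).neg) hmono.neg
  simpa only [Pi.neg_apply, mul_neg, intervalIntegral.integral_neg, abs_neg, neg_sub_neg] using hneg

lemma integral_mul_sub_midpoint_nonneg {F : ℝ → ℝ} {p q : ℝ} (hpq : p < q)
    (hF : IntervalIntegrable F volume p q) (hmono : MonotoneOn F (Ioo p q)) :
    0 ≤ ∫ x in p..q, F x * (x - (p + q) / 2) := by
  set m := (p + q) / 2 with hm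
  have hmid : m ∈ Ioo p q := ⟨by linarith, by linarith⟩
  have hlin : Continuous fun x : ℝ => x - m := by fun_prop
  have hodd : ∫ x in p..q, F m * (x - m) = 0 :=
    integral_eq_zero_of_odd fun x => by rw [hm]; ring
  rw [← hodd]
  refine intervalIntegral.integral_mono_on_of_le_Ioo hpq.le
    ((hlin.intervalIntegrable _ _).const_mul _) (hF.mul_continuousOn hlin.continuousOn)
    fun x hx => ?_
  rcases le_total x m with hxm | hxm
  · exact mul_le_mul_of_nonpos_right (hmono hx hmid hxm) (by linarith)
  · exact mul_le_mul_of_nonneg_right (hmono hmid hx hxm) (by linarith)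

end IntervalIntegral

-- The potential `P` follows `m` up to the peak and `2 S - m` after it, so it is monotone with
-- values in `[0, 2 S]` and dominates the variation of `m`.
lemma sum_abs_sub_succ_le_of_unimodal {m : ℕ → ℝ} {S : ℝ} {i : ℕ} (hm : ∀ n, m n ∈ Icc 0 S)
    (hinc : MonotoneOn m (Iio i)) (hdec : AntitoneOn m (Ici i)) (K : ℕ) :
    ∑ n ∈ Finset.range K, |m n - m (n + 1)| ≤ 2 * S := by
  let P : ℕ → ℝ := fun n => if n < i then m n else 2 * S - m n
  have hP (n) : P n ∈ Icc 0 (2 * S) := by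
    have ⟨h₀, hS⟩ := hm n
    simp only [P]
    split_ifs <;> constructor <;> linarith
  have hstep (n) : |m n - m (n + 1)| ≤ P (n + 1) - P n := by
    rcases lt_trichotomy (n + 1) i with h | h | h
    · have hn : n < i := n.lt_succ_self.trans h
      have hle : m n ≤ m (n + 1) := hinc hn h n.le_succ
      simp only [P, if_pos h, if_pos hn]
      rw [abs_of_nonpos (by linarith)]
      linarith
    · have hn : n < i := by omega
      simp only [P, if_neg h.not_lt, if_pos hn]
      exact abs_le.2 ⟨by linarith [(hm (n + 1)).2], by linarith [(hm n).2]⟩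
    · have hn : i ≤ n := Nat.lt_succ_iff.1 h
      have hle : m (n + 1) ≤ m n := hdec hn h.le n.le_succ
      simp only [P, if_neg h.not_gt, if_neg hn.not_gt]
      rw [abs_of_nonneg (by linarith)]
      linarith
  calc ∑ n ∈ Finset.range K, |m n - m (n + 1)|
      ≤ ∑ n ∈ Finset.range K, (P (n + 1) - P n) := Finset.sum_le_sum fun n _ => hstep n
    _ = P K - P 0 := Finset.sum_range_sub P K
    _ ≤ 2 * S := by linarith [(hP K).2, (hP 0).1]

/-- The weakly singular kernel `|X - x|^{-γ}`; at `x = X` it has the junk value `1 / 0 = 0` if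
`γ ≠ 0`. -/
noncomputable def kern (γ X x : ℝ) : ℝ := 1 / |X - x| ^ γ

section Kernel

variable {γ X p q h s x y : ℝ}

lemma kern_nonneg (γ X x : ℝ) : 0 ≤ kern γ X x := by
  unfold kern; positivity

lemma kern_reflect (γ s X x : ℝ) : kern γ (s - X) (s - x) = kern γ X x := by
  unfold kern
  rw [sub_sub_sub_cancel_left, abs_sub_comm]

lemma kern_of_le (hx : X ≤ x) : kern γ X x = (x - X) ^ (-γ) := by
  unfold kern
  rw [abs_sub_comm, abs_of_nonneg (sub_nonneg.2 hx), Real.rpow_neg (sub_nonneg.2 hx), one_div]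

lemma kern_le_kern (hγ₀ : 0 ≤ γ) (hx : x ≠ X) (hxy : |X - x| ≤ |X - y|) :
    kern γ X y ≤ kern γ X x := by
  have hpos : 0 < |X - x| := abs_pos.2 (sub_ne_zero.2 hx.symm)
  exact one_div_le_one_div_of_le (Real.rpow_pos_of_pos hpos γ)
    (Real.rpow_le_rpow hpos.le hxy hγ₀)

lemma antitoneOn_kern (hγ₀ : 0 ≤ γ) (X : ℝ) : AntitoneOn (kern γ X) (Ioi X) := by
  intro x hx y hy hxy
  refine kern_le_kern hγ₀ (ne_of_gt hx) ?_
  rw [abs_sub_comm X x, abs_sub_comm X y, abs_of_pos (sub_pos.2 hx), abs_of_pos (sub_pos.2 hy)]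
  linarith

lemma monotoneOn_kern (hγ₀ : 0 ≤ γ) (X : ℝ) : MonotoneOn (kern γ X) (Iio X) := by
  intro x hx y hy hxy
  refine kern_le_kern hγ₀ (ne_of_lt hy) ?_
  rw [abs_of_pos (sub_pos.2 hy), abs_of_pos (sub_pos.2 hx)]
  linarith

lemma intervalIntegrable_kern (hγ₁ : γ < 1) (X p q : ℝ) :
    IntervalIntegrable (kern γ X) volume p q := by
  have hright {q} (hq : X ≤ q) : IntervalIntegrable (kern γ X) volume X q := by
    have hpow : IntervalIntegrable (fun x : ℝ => x ^ (-γ)) volume 0 (q - X) :=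
      intervalIntegral.intervalIntegrable_rpow' (by linarith)
    have hshift := hpow.comp_sub_right X
    rw [zero_add, sub_add_cancel] at hshift
    refine hshift.congr fun x hx => ?_
    rw [uIoc_of_le hq] at hx
    exact (kern_of_le hx.1.le).symm
  have hfrom (q) : IntervalIntegrable (kern γ X) volume X q := by
    rcases le_total X q with hq | hq
    · exact hright hq
    · have hmirror := (hright (q := X + X - q) (by linarith)).comp_sub_left (X + X)
      rw [add_sub_cancel_right, sub_sub_cancel] at hmirror
      refine hmirror.congr fun x _ => ?_
      have := kern_reflect γ (X + X) X x
      rwa [add_sub_cancel_right] at this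
  exact (hfrom p).symm.trans (hfrom q)

lemma integral_kern_reflect (γ X p q s : ℝ) :
    ∫ x in p..q, kern γ X x = ∫ x in s - q..s - p, kern γ (s - X) x := by
  rw [← intervalIntegral.integral_comp_sub_left (kern γ (s - X))]
  simp only [kern_reflect]

lemma integral_kern_right (hγ₁ : γ < 1) (X : ℝ) (hs : 0 ≤ s) :
    ∫ x in X..X + s, kern γ X x = s ^ (1 - γ) / (1 - γ) := by
  have hpow : ∫ x in X..X + s, kern γ X x = ∫ x in X..X + s, (fun y => y ^ (-γ)) (x - X) := by
    refine intervalIntegral.integral_congr fun x hx => ?_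
    rw [uIcc_of_le (by linarith)] at hx
    exact kern_of_le hx.1
  rw [hpow, intervalIntegral.integral_comp_sub_right (fun y => y ^ (-γ)), sub_self,
    add_sub_cancel_left, integral_rpow (Or.inl (by linarith)), Real.zero_rpow (by linarith),
    neg_add_eq_sub, sub_zero]

lemma integral_kern_left (hγ₁ : γ < 1) (X : ℝ) (hs : 0 ≤ s) :
    ∫ x in X - s..X, kern γ X x = s ^ (1 - γ) / (1 - γ) := by
  rw [integral_kern_reflect γ X _ _ (2 * X), ← integral_kern_right hγ₁ X hs]
  congr 1 <;> ring_nf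

lemma integral_kern_nonneg (γ X : ℝ) (hpq : p ≤ q) : 0 ≤ ∫ x in p..q, kern γ X x :=
  intervalIntegral.integral_nonneg hpq fun x _ => kern_nonneg γ X x

lemma integral_kern_add_le (hγ₀ : 0 ≤ γ) (hγ₁ : γ < 1) (hX : X ≤ p) (hpq : p ≤ q) (hs : 0 ≤ s) :
    ∫ x in p + s..q + s, kern γ X x ≤ ∫ x in p..q, kern γ X x := by
  rw [← intervalIntegral.integral_comp_add_right (kern γ X)]
  have hshift : IntervalIntegrable (fun x => kern γ X (x + s)) volume p q := by
    simpa only [add_sub_cancel_right] using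
      (intervalIntegrable_kern hγ₁ X (p + s) (q + s)).comp_add_right s
  refine intervalIntegral.integral_mono_on_of_le_Ioo hpq hshift (intervalIntegrable_kern hγ₁ X _ _)
    fun x hx => antitoneOn_kern hγ₀ X (hX.trans_lt hx.1) ?_ ?_
  · exact mem_Ioi.2 (by linarith [hx.1])
  · linarith

lemma integral_kern_sub_le (hγ₀ : 0 ≤ γ) (hγ₁ : γ < 1) (hX : q ≤ X) (hpq : p ≤ q) (hs : 0 ≤ s) :
    ∫ x in p - s..q - s, kern γ X x ≤ ∫ x in p..q, kern γ X x := by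
  have hmirror := integral_kern_add_le hγ₀ hγ₁ (neg_le_neg hX) (neg_le_neg hpq) hs
  rw [integral_kern_reflect γ X p q 0, integral_kern_reflect γ X _ _ 0]
  simpa only [zero_sub, neg_sub, neg_add_eq_sub] using hmirror

end Kernel

/-- An upper bound for `∫_a^b |X - x|^{-γ} dx`, uniform in `X ∈ [a, b]`. -/
noncomputable def kernBound (a b γ : ℝ) : ℝ := 2 * ((b - a) ^ (1 - γ) / (1 - γ))

lemma kernBound_nonneg {a b γ : ℝ} (hab : a ≤ b) (hγ₁ : γ < 1) : 0 ≤ kernBound a b γ := by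
  have : 0 ≤ b - a := sub_nonneg.2 hab
  have : 0 ≤ 1 - γ := sub_nonneg.2 hγ₁.le
  unfold kernBound
  positivity

lemma integral_kern_le_kernBound {a b γ X : ℝ} (hγ₁ : γ < 1) (hX : X ∈ Icc a b) :
    ∫ x in a..b, kern γ X x ≤ kernBound a b γ := by
  have hlength : 0 ≤ b - a := by linarith [hX.1, hX.2]
  calc ∫ x in a..b, kern γ X x ≤ ∫ x in X - (b - a)..X + (b - a), kern γ X x :=
        intervalIntegral.integral_mono_interval (by linarith [hX.2]) (by linarith)
          (by linarith [hX.1]) (Filter.Eventually.of_forall fun x => kern_nonneg γ X x)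
          (intervalIntegrable_kern hγ₁ X _ _)
    _ = kernBound a b γ := by
        rw [← intervalIntegral.integral_add_adjacent_intervals
          (intervalIntegrable_kern hγ₁ X _ X) (intervalIntegrable_kern hγ₁ X X _),
          integral_kern_left hγ₁ X hlength, integral_kern_right hγ₁ X hlength, kernBound, two_mul]

section Nodes

variable {a b h : ℝ} {M i j : ℕ}

lemma node_zero (a h : ℝ) : node a h 0 = a := by simp [node]

lemma node_add_one (a h s : ℝ) : node a h (s + 1) = node a h s + h := by unfold node; ring

lemma node_add_half (a h s : ℝ) : node a h (s + 1 / 2) = node a h s + h / 2 := by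
  unfold node; ring

lemma node_div_two (a h s : ℝ) : node a h (s / 2) = node a (h / 2) s := by unfold node; ring

lemma node_lt_node (hh : 0 < h) (a : ℝ) {s t : ℝ} : node a h s < node a h t ↔ s < t := by
  simp [node, hh]

lemma node_le_node (hh : 0 < h) (a : ℝ) {s t : ℝ} : node a h s ≤ node a h t ↔ s ≤ t := by
  simp [node, hh]

lemma step_pos (hab : a < b) (hM : 1 ≤ M) : 0 < step a b M :=
  div_pos (sub_pos.2 hab) (Nat.cast_pos.2 hM)

lemma node_step_last (a b : ℝ) (hM : 1 ≤ M) : node a (step a b M) M = b := by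
  have hM' : (M : ℝ) ≠ 0 := Nat.cast_ne_zero.2 (by omega)
  unfold node step
  field_simp
  ring

lemma cell_subset (hab : a < b) (hM : 1 ≤ M) (hj : j < M) :
    Icc (node a (step a b M) j) (node a (step a b M) j + step a b M) ⊆ Icc a b := by
  have hh := step_pos hab hM
  have hj' : (j : ℝ) + 1 ≤ M := by exact_mod_cast hj
  have hleft : node a (step a b M) 0 ≤ node a (step a b M) j :=
    (node_le_node hh a).2 (Nat.cast_nonneg j)
  have hright : node a (step a b M) (j + 1) ≤ node a (step a b M) M := (node_le_node hh a).2 hj'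
  rw [node_zero] at hleft
  rw [node_add_one, node_step_last a b hM] at hright
  exact Icc_subset_Icc hleft hright

/-- The node `x_{i/2}` of the partition of `[a, b]` into `M` cells. -/
noncomputable abbrev halfNode (a b : ℝ) (M i : ℕ) : ℝ := node a (step a b M) ((i : ℝ) / 2)

lemma halfNode_zero (a b : ℝ) (M : ℕ) : halfNode a b M 0 = a := by simp [halfNode, node]

lemma halfNode_last (a b : ℝ) (hM : 1 ≤ M) : halfNode a b M (2 * M) = b := by
  rw [halfNode, Nat.cast_mul, Nat.cast_two, mul_div_cancel_left₀ _ two_ne_zero,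
    node_step_last a b hM]

lemma halfNode_mem_Icc (hab : a < b) (hM : 1 ≤ M) (hi : i ≤ 2 * M) :
    halfNode a b M i ∈ Icc a b := by
  have hh := step_pos hab hM
  have hi' : (i : ℝ) ≤ (2 * M : ℕ) := Nat.cast_le.2 hi
  constructor
  · nth_rw 1 [← halfNode_zero a b M]
    exact (node_le_node hh a).2 (by rw [Nat.cast_zero]; gcongr; exact i.cast_nonneg)
  · nth_rw 2 [← halfNode_last a b hM]
    exact (node_le_node hh a).2 (by linarith)

lemma halfNode_succ_mem_Ioo (hab : a < b) (hM : 1 ≤ M) (i : Fin (2 * M - 1)) :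
    halfNode a b M (i + 1) ∈ Ioo a b := by
  have hh := step_pos hab hM
  have hi' : ((i + 1 : ℕ) : ℝ) < (2 * M : ℕ) := Nat.cast_lt.2 (by omega)
  constructor
  · nth_rw 1 [← halfNode_zero a b M]
    exact (node_lt_node hh a).2 (by rw [Nat.cast_zero]; gcongr; exact Nat.cast_pos.2 i.succ_pos)
  · nth_rw 2 [← halfNode_last a b hM]
    exact (node_lt_node hh a).2 (by linarith)

end Nodes

/-- The mass of the kernel with singularity at the `i`-th point of the grid `a + n δ` on the `n`-th
interval of that grid. -/
noncomputable def gridMass (γ a δ : ℝ) (i n : ℕ) : ℝ :=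
  ∫ x in node a δ n..node a δ (n + 1), kern γ (node a δ i) x

section GridMass

variable {γ δ : ℝ} {i : ℕ}

lemma monotoneOn_gridMass (hγ₀ : 0 ≤ γ) (hγ₁ : γ < 1) (a : ℝ) (hδ : 0 < δ) (i : ℕ) :
    MonotoneOn (gridMass γ a δ i) (Iio i) := by
  intro m _ n hn hmn
  have hshift : 0 ≤ ((n : ℝ) - m) * δ := mul_nonneg (by simpa using hmn) hδ.le
  have hX : node a δ (n + 1) ≤ node a δ i :=
    (node_le_node hδ a).2 (by exact_mod_cast Nat.succ_le_of_lt hn)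
  refine (le_of_eq ?_).trans (integral_kern_sub_le hγ₀ hγ₁ hX
    ((node_le_node hδ a).2 (by linarith)) hshift)
  unfold gridMass node
  congr 1 <;> ring

lemma antitoneOn_gridMass (hγ₀ : 0 ≤ γ) (hγ₁ : γ < 1) (a : ℝ) (hδ : 0 < δ) (i : ℕ) :
    AntitoneOn (gridMass γ a δ i) (Ici i) := by
  intro m hm n _ hmn
  have hshift : 0 ≤ ((n : ℝ) - m) * δ := mul_nonneg (by simpa using hmn) hδ.le
  have hX : node a δ i ≤ node a δ m := (node_le_node hδ a).2 (by exact_mod_cast hm)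
  refine (le_of_eq ?_).trans (integral_kern_add_le hγ₀ hγ₁ hX
    ((node_le_node hδ a).2 (by linarith)) hshift)
  unfold gridMass node
  congr 1 <;> ring

lemma gridMass_mem_Icc (hγ₀ : 0 ≤ γ) (hγ₁ : γ < 1) (a : ℝ) (hδ : 0 < δ) (i n : ℕ) :
    gridMass γ a δ i n ∈ Icc 0 (δ ^ (1 - γ) / (1 - γ)) := by
  refine ⟨integral_kern_nonneg γ _ ((node_le_node hδ a).2 (by linarith)), ?_⟩
  rcases lt_or_ge n i with hn | hn
  · obtain ⟨j, rfl⟩ : ∃ j, i = j + 1 := Nat.exists_eq_succ_of_ne_zero (by omega)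
    refine (monotoneOn_gridMass hγ₀ hγ₁ a hδ _ hn j.lt_succ_self (Nat.lt_succ_iff.1 hn)).trans_eq ?_
    rw [← integral_kern_left hγ₁ (node a δ (j + 1 : ℕ)) hδ.le, gridMass]
    congr 1 <;> unfold node <;> push_cast <;> ring
  · refine (antitoneOn_gridMass hγ₀ hγ₁ a hδ i self_mem_Ici hn hn).trans_eq ?_
    rw [gridMass, node_add_one, integral_kern_right hγ₁ _ hδ.le]

lemma sum_abs_gridMass_sub_le (hγ₀ : 0 ≤ γ) (hγ₁ : γ < 1) (a : ℝ) (hδ : 0 < δ) (i M : ℕ) :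
    ∑ l ∈ Finset.range M, |gridMass γ a δ i (2 * l) - gridMass γ a δ i (2 * l + 1)| ≤
      2 * (δ ^ (1 - γ) / (1 - γ)) := by
  calc ∑ l ∈ Finset.range M, |gridMass γ a δ i (2 * l) - gridMass γ a δ i (2 * l + 1)|
      = ∑ n ∈ (Finset.range M).image (2 * ·), |gridMass γ a δ i n - gridMass γ a δ i (n + 1)| :=
        by rw [Finset.sum_image fun _ _ _ _ h => Nat.eq_of_mul_eq_mul_left two_pos h]
    _ ≤ ∑ n ∈ Finset.range (2 * M), |gridMass γ a δ i n - gridMass γ a δ i (n + 1)| := by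
        refine Finset.sum_le_sum_of_subset_of_nonneg (fun n hn => ?_) fun _ _ _ => abs_nonneg _
        simp only [Finset.mem_image, Finset.mem_range] at hn ⊢
        omega
    _ ≤ 2 * (δ ^ (1 - γ) / (1 - γ)) :=
        sum_abs_sub_succ_le_of_unimodal (gridMass_mem_Icc hγ₀ hγ₁ a hδ i)
          (monotoneOn_gridMass hγ₀ hγ₁ a hδ i) (antitoneOn_gridMass hγ₀ hγ₁ a hδ i) _

end GridMass

/-- The cubic polynomial vanishing at the two end points and the midpoint of `[p, p + h]`. -/
noncomputable def nodal (p h x : ℝ) : ℝ := (x - p) * (x - (p + h / 2)) * (x - (p + h))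

/-- The quadratic Lagrange basis polynomial on `[p, p + h]` that is `1` at `p`. -/
noncomputable def lagrangeLeft (p h x : ℝ) : ℝ := (p + h - x) * (2 * p + h - 2 * x) / h ^ 2

/-- The quadratic Lagrange basis polynomial on `[p, p + h]` that is `1` at `p + h / 2`. -/
noncomputable def lagrangeMid (p h x : ℝ) : ℝ := 4 * (x - p) * (p + h - x) / h ^ 2

/-- The quadratic Lagrange basis polynomial on `[p, p + h]` that is `1` at `p + h`. -/
noncomputable def lagrangeRight (p h x : ℝ) : ℝ := (x - p) * (2 * x - 2 * p - h) / h ^ 2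

/-- The quadratic interpolant of `w` at the end points and the midpoint of `[p, p + h]`. -/
noncomputable def quadInterp (p h : ℝ) (w : ℝ → ℝ) (x : ℝ) : ℝ :=
  w p * lagrangeLeft p h x + w (p + h / 2) * lagrangeMid p h x + w (p + h) * lagrangeRight p h x

section Cell

variable {p h x : ℝ}

@[fun_prop]
lemma continuous_nodal (p h : ℝ) : Continuous (nodal p h) := by unfold nodal; fun_prop

@[fun_prop]
lemma continuous_lagrangeLeft (p h : ℝ) : Continuous (lagrangeLeft p h) := by
  unfold lagrangeLeft; fun_prop

@[fun_prop]
lemma continuous_lagrangeMid (p h : ℝ) : Continuous (lagrangeMid p h) := by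
  unfold lagrangeMid; fun_prop

@[fun_prop]
lemma continuous_lagrangeRight (p h : ℝ) : Continuous (lagrangeRight p h) := by
  unfold lagrangeRight; fun_prop

@[fun_prop]
lemma continuous_quadInterp (p h : ℝ) (w : ℝ → ℝ) : Continuous (quadInterp p h w) := by
  unfold quadInterp; fun_prop

lemma nodal_reflect (p h x : ℝ) : nodal p h (p + (p + h) - x) = -nodal p h x := by
  unfold nodal; ring

lemma lagrangeRight_reflect (p h x : ℝ) :
    lagrangeRight p h (p + (p + h) - x) = lagrangeLeft p h x := by
  unfold lagrangeLeft lagrangeRight; ring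

lemma lagrange_sum (hh : h ≠ 0) (p x : ℝ) :
    lagrangeLeft p h x + lagrangeMid p h x + lagrangeRight p h x = 1 := by
  unfold lagrangeLeft lagrangeMid lagrangeRight; field_simp; ring

lemma lagrangeMid_nonneg (hx : x ∈ Icc p (p + h)) : 0 ≤ lagrangeMid p h x := by
  have hleft : 0 ≤ x - p := sub_nonneg.2 hx.1
  have hright : 0 ≤ p + h - x := sub_nonneg.2 hx.2
  unfold lagrangeMid; positivity

lemma abs_lagrangeMid_le (hh : 0 < h) (hx : x ∈ Icc p (p + h)) : |lagrangeMid p h x| ≤ 1 := by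
  rw [abs_of_nonneg (lagrangeMid_nonneg hx), lagrangeMid, div_le_one (by positivity)]
  nlinarith [sq_nonneg (2 * x - 2 * p - h)]

lemma abs_lagrangeRight_le (hh : 0 < h) (hx : x ∈ Icc p (p + h)) :
    |lagrangeRight p h x| ≤ 1 := by
  have hleft : |x - p| ≤ h := abs_le.2 ⟨by linarith [hx.1], by linarith [hx.2]⟩
  have hmid : |2 * x - 2 * p - h| ≤ h := abs_le.2 ⟨by linarith [hx.1], by linarith [hx.2]⟩
  rw [lagrangeRight, abs_div, abs_mul, abs_of_nonneg (sq_nonneg h), div_le_one (by positivity), sq]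
  gcongr

lemma abs_lagrangeLeft_le (hh : 0 < h) (hx : x ∈ Icc p (p + h)) : |lagrangeLeft p h x| ≤ 1 := by
  rw [← lagrangeRight_reflect]
  exact abs_lagrangeRight_le hh ⟨by linarith [hx.2], by linarith [hx.1]⟩

lemma abs_nodal_le (hx : x ∈ Icc p (p + h)) : |nodal p h x| ≤ h ^ 3 := by
  have hleft : |x - p| ≤ h := abs_le.2 ⟨by linarith [hx.1, hx.2], by linarith [hx.2]⟩
  have hmid : |x - (p + h / 2)| ≤ h := abs_le.2 ⟨by linarith [hx.1, hx.2], by linarith [hx.1, hx.2]⟩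
  have hright : |x - (p + h)| ≤ h := abs_le.2 ⟨by linarith [hx.1], by linarith [hx.1, hx.2]⟩
  have hh : 0 ≤ h := (abs_nonneg _).trans hleft
  calc |nodal p h x| = |x - p| * |x - (p + h / 2)| * |x - (p + h)| := by
        rw [nodal, abs_mul, abs_mul]
    _ ≤ h * h * h := by gcongr
    _ = h ^ 3 := by ring

lemma abs_quadInterp_le (hh : 0 < h) (hx : x ∈ Icc p (p + h)) {w : ℝ → ℝ} {ε : ℝ}
    (hw : ∀ y ∈ Icc p (p + h), |w y| ≤ ε) : |quadInterp p h w x| ≤ 3 * ε := by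
  have hε : 0 ≤ ε := (abs_nonneg _).trans (hw x hx)
  have hterm {y l : ℝ} (hy : y ∈ Icc p (p + h)) (hl : |l| ≤ 1) : |w y * l| ≤ ε := by
    rw [abs_mul]
    exact (mul_le_mul (hw y hy) hl (abs_nonneg _) hε).trans_eq (mul_one ε)
  have hleft := hterm (y := p) ⟨le_rfl, by linarith⟩ (abs_lagrangeLeft_le hh hx)
  have hmid := hterm (y := p + h / 2) ⟨by linarith, by linarith⟩ (abs_lagrangeMid_le hh hx)
  have hright := hterm (y := p + h) ⟨by linarith, le_rfl⟩ (abs_lagrangeRight_le hh hx)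
  exact (abs_add_three _ _ _).trans (by linarith)

lemma quadInterp_sub (p h : ℝ) (v w : ℝ → ℝ) (x : ℝ) :
    quadInterp p h (v - w) x = quadInterp p h v x - quadInterp p h w x := by
  simp only [quadInterp, Pi.sub_apply]; ring

lemma cubic_sub_quadInterp (hh : h ≠ 0) (p c₀ c₁ c₂ c₃ x : ℝ) :
    (c₀ + c₁ * (x - p) + c₂ * (x - p) ^ 2 + c₃ * (x - p) ^ 3) -
      quadInterp p h (fun y => c₀ + c₁ * (y - p) + c₂ * (y - p) ^ 2 + c₃ * (y - p) ^ 3) x =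
        c₃ * nodal p h x := by
  unfold quadInterp lagrangeLeft lagrangeMid lagrangeRight nodal
  field_simp
  ring

lemma integral_nodal (p h : ℝ) : ∫ x in p..p + h, nodal p h x = 0 :=
  integral_eq_zero_of_odd (nodal_reflect p h)

end Cell

/-- `X` is the midpoint of the cell `[p, p + h]` or is not an interior point of it. This is the
position of a node `x_{i/2}` relative to a cell of the partition. -/
def CellAligned (p h X : ℝ) : Prop := X ≤ p ∨ X = p + h / 2 ∨ p + h ≤ X

section KernelOnCell

variable {γ X p h : ℝ}

lemma CellAligned.reflect (hX : CellAligned p h X) : CellAligned p h (p + (p + h) - X) := by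
  rcases hX with hX | hX | hX
  · exact Or.inr (Or.inr (by linarith))
  · exact Or.inr (Or.inl (by linarith))
  · exact Or.inl (by linarith)

lemma cellAligned_node {h : ℝ} (hh : 0 < h) (a : ℝ) (i j : ℕ) :
    CellAligned (node a h j) h (node a h ((i : ℝ) / 2)) := by
  unfold CellAligned
  rw [← node_add_one, ← node_add_half, node_le_node hh, node_le_node hh]
  rcases lt_trichotomy i (2 * j + 1) with hi | hi | hi
  · have : (i : ℝ) ≤ 2 * j := by exact_mod_cast Nat.le_of_lt_succ hi
    exact Or.inl (by linarith)
  · refine Or.inr (Or.inl ?_)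
    rw [hi]
    congr 1
    push_cast
    ring
  · have : (2 * j + 1 + 1 : ℝ) ≤ i := by exact_mod_cast hi
    exact Or.inr (Or.inr (by linarith))

lemma kern_reflect_midpoint (γ p h x : ℝ) :
    kern γ (p + h / 2) (p + (p + h) - x) = kern γ (p + h / 2) x := by
  rw [← kern_reflect γ (p + (p + h)) (p + h / 2) x]
  congr 1
  ring

-- For `X ≤ p` the product is `(x - p)^(1 - γ) ((x - p) / (x - X))^γ`.
lemma monotoneOn_sub_mul_kern (hγ₀ : 0 ≤ γ) (hγ₁ : γ < 1) (hX : X ≤ p ∨ p + h ≤ X) :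
    MonotoneOn (fun x => (x - p) * kern γ X x) (Ioo p (p + h)) := by
  intro x hx y hy hxy
  rcases hX with hX | hX
  · have hfactor {z} (hz : p < z) :
        (z - p) * kern γ X z = (z - p) ^ (1 - γ) * ((z - p) / (z - X)) ^ γ := by
      have hzp : 0 < z - p := sub_pos.2 hz
      have hzX : 0 < z - X := sub_pos.2 (hX.trans_lt hz)
      have hne := (Real.rpow_pos_of_pos hzp γ).ne'
      rw [kern_of_le (hX.trans hz.le), Real.div_rpow hzp.le hzX.le, Real.rpow_neg hzX.le,
        Real.rpow_sub hzp, Real.rpow_one]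
      field_simp
    have hxp : 0 < x - p := sub_pos.2 hx.1
    have hyp : 0 < y - p := sub_pos.2 hy.1
    have hxX : 0 < x - X := sub_pos.2 (hX.trans_lt hx.1)
    have hyX : 0 < y - X := sub_pos.2 (hX.trans_lt hy.1)
    have : 0 ≤ 1 - γ := sub_nonneg.2 hγ₁.le
    have hquot : (x - p) / (x - X) ≤ (y - p) / (y - X) := by
      rw [div_le_div_iff₀ hxX hyX]
      nlinarith
    simp only [hfactor hx.1, hfactor hy.1]
    gcongr
  · exact mul_le_mul (by linarith)
      (monotoneOn_kern hγ₀ X (hx.2.trans_le hX) (hy.2.trans_le hX) hxy) (kern_nonneg _ _ _)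
      (by linarith [hy.1])

lemma integral_lagrangeRight_mul_kern_midpoint_nonneg (hγ₁ : γ < 1) (hh : 0 < h) :
    0 ≤ ∫ x in p..p + h, lagrangeRight p h x * kern γ (p + h / 2) x := by
  have hodd : ∫ x in p..p + h, 1 / h * (x - (p + h / 2)) * kern γ (p + h / 2) x = 0 :=
    integral_eq_zero_of_odd fun x => by rw [kern_reflect_midpoint]; ring
  rw [← hodd]
  refine intervalIntegral.integral_mono_on (by linarith)
    ((intervalIntegrable_kern hγ₁ _ _ _).continuousOn_mul (by fun_prop))
    ((intervalIntegrable_kern hγ₁ _ _ _).continuousOn_mul (by fun_prop)) fun x _ =>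
      mul_le_mul_of_nonneg_right ?_ (kern_nonneg _ _ _)
  have hsplit : lagrangeRight p h x =
      1 / h * (x - (p + h / 2)) + 2 * (x - (p + h / 2)) ^ 2 / h ^ 2 := by
    unfold lagrangeRight; field_simp; ring
  rw [hsplit]
  exact le_add_of_nonneg_right (by positivity)

lemma integral_lagrangeRight_mul_kern_nonneg (hγ₀ : 0 ≤ γ) (hγ₁ : γ < 1) (hh : 0 < h)
    (hX : CellAligned p h X) : 0 ≤ ∫ x in p..p + h, lagrangeRight p h x * kern γ X x := by
  by_cases hmid : X = p + h / 2
  · rw [hmid]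
    exact integral_lagrangeRight_mul_kern_midpoint_nonneg hγ₁ hh
  · have hX' : X ≤ p ∨ p + h ≤ X := by unfold CellAligned at hX; tauto
    have hnonneg := integral_mul_sub_midpoint_nonneg (by linarith)
      ((intervalIntegrable_kern hγ₁ X p (p + h)).continuousOn_mul (by fun_prop))
      (monotoneOn_sub_mul_kern hγ₀ hγ₁ hX')
    have hscale (x : ℝ) : lagrangeRight p h x * kern γ X x =
        2 / h ^ 2 * ((x - p) * kern γ X x * (x - (p + (p + h)) / 2)) := by
      unfold lagrangeRight; ring
    simp only [hscale, intervalIntegral.integral_const_mul]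
    exact mul_nonneg (by positivity) hnonneg

lemma integral_lagrangeLeft_mul_kern_nonneg (hγ₀ : 0 ≤ γ) (hγ₁ : γ < 1) (hh : 0 < h)
    (hX : CellAligned p h X) : 0 ≤ ∫ x in p..p + h, lagrangeLeft p h x * kern γ X x := by
  have hmirror := intervalIntegral.integral_comp_sub_left (a := p) (b := p + h)
    (fun x => lagrangeRight p h x * kern γ (p + (p + h) - X) x) (p + (p + h))
  simp only [lagrangeRight_reflect, kern_reflect, add_sub_cancel_right, add_sub_cancel_left]
    at hmirror
  rw [hmirror]
  exact integral_lagrangeRight_mul_kern_nonneg hγ₀ hγ₁ hh hX.reflect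

lemma integral_lagrangeMid_mul_kern_nonneg (hh : 0 < h) :
    0 ≤ ∫ x in p..p + h, lagrangeMid p h x * kern γ X x :=
  intervalIntegral.integral_nonneg (by linarith) fun _ hx =>
    mul_nonneg (lagrangeMid_nonneg hx) (kern_nonneg _ _ _)

lemma abs_integral_nodal_mul_kern_le (hγ₀ : 0 ≤ γ) (hγ₁ : γ < 1) (hh : 0 < h)
    (hX : CellAligned p h X) :
    |∫ x in p..p + h, nodal p h x * kern γ X x| ≤
      h ^ 3 * |(∫ x in p..p + h / 2, kern γ X x) - ∫ x in p + h / 2..p + h, kern γ X x| := by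
  have hI := intervalIntegrable_kern hγ₁ X
  have hC : ∀ x ∈ Icc p (p + h), |nodal p h x| ≤ h ^ 3 := fun x => abs_nodal_le
  rcases hX with hX | hX | hX
  · refine (abs_integral_mul_le_of_antitoneOn hh (continuous_nodal p h) (integral_nodal p h) hC hI
      ((antitoneOn_kern hγ₀ X).mono fun x hx => hX.trans_lt hx.1)).trans ?_
    gcongr
    exact le_abs_self _
  · have hodd : ∫ x in p..p + h, nodal p h x * kern γ X x = 0 :=
      integral_eq_zero_of_odd fun x => by
        rw [hX, nodal_reflect, kern_reflect_midpoint, neg_mul]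
    rw [hodd, abs_zero]
    positivity
  · refine (abs_integral_mul_le_of_monotoneOn hh (continuous_nodal p h) (integral_nodal p h) hC hI
      ((monotoneOn_kern hγ₀ X).mono fun x hx => hx.2.trans_le hX)).trans ?_
    rw [abs_sub_comm]
    gcongr
    exact le_abs_self _

end KernelOnCell

/-- The polynomial that agrees with the basis function `φ_{l/2}` on the open cell
`(x_j, x_{j+1})`. -/
noncomputable def cellBasis (a h : ℝ) (j l : ℕ) (x : ℝ) : ℝ :=
  if l = 2 * j then lagrangeLeft (node a h j) h x
  else if l = 2 * j + 1 then lagrangeMid (node a h j) h x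
  else if l = 2 * j + 2 then lagrangeRight (node a h j) h x else 0

section BasisOnCell

variable {a h x : ℝ} {j l m M : ℕ}

lemma vertexBasis_of_mem_cell (hh : 0 < h) (hx : x ∈ Ioo (node a h j) (node a h j + h)) :
    vertexBasis a h m x =
      if m = j then lagrangeLeft (node a h j) h x
      else if m = j + 1 then lagrangeRight (node a h j) h x else 0 := by
  obtain ⟨hxj, hxj'⟩ := hx
  rw [← node_add_one] at hxj'
  have hle {s t : ℝ} (hst : s ≤ t) : node a h s ≤ node a h t := (node_le_node hh a).2 hst
  unfold vertexBasis
  rcases lt_or_ge m j with hmj | hmj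
  · have hm : (m : ℝ) + 1 ≤ j := by exact_mod_cast hmj
    rw [if_neg fun H => by linarith [H.2, hle (show (m : ℝ) ≤ j by linarith)],
      if_neg fun H => by linarith [H.2, hle hm], if_neg (by omega), if_neg (by omega)]
  rcases eq_or_lt_of_le hmj with rfl | hjm
  · rw [if_neg fun H => by linarith [H.2], if_pos ⟨hxj.le, hxj'.le⟩, if_pos rfl, node_add_one]
    unfold lagrangeLeft; field_simp; ring
  rcases eq_or_lt_of_le (Nat.succ_le_of_lt hjm) with rfl | hjm'
  · rw [Nat.succ_eq_add_one, Nat.cast_succ, add_sub_cancel_right, if_pos ⟨hxj.le, hxj'.le⟩,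
      if_neg (by omega), if_pos rfl, node_add_one]
    unfold lagrangeRight; field_simp; ring
  · have hm : (j : ℝ) + 1 + 1 ≤ m := by exact_mod_cast hjm'
    rw [if_neg fun H => by linarith [H.1, hle (show (j : ℝ) + 1 ≤ m - 1 by linarith)],
      if_neg fun H => by linarith [H.1, hle (show (j : ℝ) + 1 ≤ m by linarith)],
      if_neg (by omega), if_neg (by omega)]

lemma midBasis_of_mem_cell (hh : 0 < h) (hx : x ∈ Ioo (node a h j) (node a h j + h)) :
    midBasis a h (m + 1 / 2) x = if m = j then lagrangeMid (node a h j) h x else 0 := by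
  obtain ⟨hxj, hxj'⟩ := hx
  unfold midBasis
  rw [add_sub_cancel_right, add_assoc, add_halves]
  rcases lt_trichotomy m j with hmj | rfl | hjm
  · have hle : node a h (m + 1) ≤ node a h j := (node_le_node hh a).2 (by exact_mod_cast hmj)
    rw [if_neg fun H => by linarith [H.2], if_neg hmj.ne]
  · rw [node_add_one, if_pos ⟨hxj.le, hxj'.le⟩, if_pos rfl, lagrangeMid]
  · have hle : node a h (j + 1) ≤ node a h m := (node_le_node hh a).2 (by exact_mod_cast hjm)
    rw [node_add_one] at hle
    rw [if_neg fun H => by linarith [H.1], if_neg hjm.ne']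

lemma basis_of_mem_cell (hh : 0 < h) (hx : x ∈ Ioo (node a h j) (node a h j + h)) :
    basis a h l x = cellBasis a h j l x := by
  unfold basis cellBasis
  rcases Nat.even_or_odd' l with ⟨m, rfl | rfl⟩
  · rw [if_pos (even_two_mul m), Nat.cast_mul, Nat.cast_two,
      mul_div_cancel_left₀ _ two_ne_zero, vertexBasis_of_mem_cell hh hx]
    split_ifs <;> first | rfl | omega
  · have hhalf : ((2 * m + 1 : ℕ) : ℝ) / 2 = m + 1 / 2 := by push_cast; ring
    rw [if_neg (Nat.not_even_iff_odd.2 (odd_two_mul_add_one m)), hhalf, midBasis_of_mem_cell hh hx]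
    split_ifs <;> first | rfl | omega

lemma continuous_cellBasis (a h : ℝ) (j l : ℕ) : Continuous (cellBasis a h j l) := by
  unfold cellBasis
  split_ifs <;> fun_prop

lemma sum_cellBasis_mul (a h : ℝ) (hj : j < M) (w : ℝ → ℝ) (x : ℝ) :
    ∑ l ∈ Finset.range (2 * M + 1), cellBasis a h j l x * w (node a h ((l : ℝ) / 2)) =
      quadInterp (node a h j) h w x := by
  have hsub : ({2 * j, 2 * j + 1, 2 * j + 2} : Finset ℕ) ⊆ Finset.range (2 * M + 1) := by
    intro l hl
    simp only [Finset.mem_insert, Finset.mem_singleton] at hl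
    rw [Finset.mem_range]
    omega
  have hzero : ∀ l ∈ Finset.range (2 * M + 1), l ∉ ({2 * j, 2 * j + 1, 2 * j + 2} : Finset ℕ) →
      cellBasis a h j l x * w (node a h ((l : ℝ) / 2)) = 0 := by
    intro l _ hl
    simp only [Finset.mem_insert, Finset.mem_singleton, not_or] at hl
    simp only [cellBasis, hl.1, hl.2.1, hl.2.2, if_false, zero_mul]
  have hleft : node a h (((2 * j : ℕ) : ℝ) / 2) = node a h j := by
    unfold node; push_cast; ring
  have hmid : node a h (((2 * j + 1 : ℕ) : ℝ) / 2) = node a h j + h / 2 := by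
    unfold node; push_cast; ring
  have hright : node a h (((2 * j + 2 : ℕ) : ℝ) / 2) = node a h j + h := by
    unfold node; push_cast; ring
  rw [← Finset.sum_subset hsub hzero, Finset.sum_insert (by simp), Finset.sum_insert (by simp),
    Finset.sum_singleton, hleft, hmid, hright]
  simp [cellBasis, quadInterp, mul_comm, add_assoc]

end BasisOnCell

section Weights

variable {a b γ : ℝ} {M i : ℕ}

lemma integral_eq_sum_cells (hM : 1 ≤ M) {f : ℝ → ℝ}
    (hf : ∀ j < M, IntervalIntegrable f volume (node a (step a b M) j)
      (node a (step a b M) j + step a b M)) :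
    ∫ x in a..b, f x = ∑ j ∈ Finset.range M,
      ∫ x in node a (step a b M) j..node a (step a b M) j + step a b M, f x := by
  have hsum := intervalIntegral.sum_integral_adjacent_intervals (μ := volume) (f := f)
    (a := fun j : ℕ => node a (step a b M) j) (n := M) fun j hj => by
      rw [Nat.cast_succ, node_add_one]
      exact hf j hj
  simp only [Nat.cast_succ, Nat.cast_zero, node_zero, node_add_one, node_step_last a b hM] at hsum
  exact hsum.symm

lemma weight_eq_sum_cells (hab : a < b) (hγ₁ : γ < 1) (hM : 1 ≤ M) (i l : ℕ) :
    weight a b γ M i l = ∑ j ∈ Finset.range M,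
      ∫ x in node a (step a b M) j..node a (step a b M) j + step a b M,
        cellBasis a (step a b M) j l x * kern γ (halfNode a b M i) x := by
  have hh := step_pos hab hM
  have heq (j : ℕ) : EqOn
      (fun x => cellBasis a (step a b M) j l x * kern γ (halfNode a b M i) x)
      (fun x => basis a (step a b M) l x / |halfNode a b M i - x| ^ γ)
      (uIoo (node a (step a b M) j) (node a (step a b M) j + step a b M)) := by
    intro x hx
    rw [uIoo_of_le (by linarith)] at hx
    simp only [basis_of_mem_cell hh hx, kern, mul_one_div]
  unfold weight
  rw [integral_eq_sum_cells hM fun j _ => ?_]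
  · exact Finset.sum_congr rfl fun j _ => (intervalIntegral.integral_congr_uIoo (heq j)).symm
  · exact ((intervalIntegrable_kern hγ₁ _ _ _).continuousOn_mul
      (continuous_cellBasis _ _ _ _).continuousOn).congr_uIoo (heq j)

lemma weight_nonneg (hab : a < b) (hγ₀ : 0 ≤ γ) (hγ₁ : γ < 1) (hM : 1 ≤ M) (i l : ℕ) :
    0 ≤ weight a b γ M i l := by
  have hh := step_pos hab hM
  rw [weight_eq_sum_cells hab hγ₁ hM]
  refine Finset.sum_nonneg fun j _ => ?_
  have haligned : CellAligned _ _ (halfNode a b M i) := cellAligned_node hh a i j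
  unfold cellBasis
  split_ifs
  · exact integral_lagrangeLeft_mul_kern_nonneg hγ₀ hγ₁ hh haligned
  · exact integral_lagrangeMid_mul_kern_nonneg hh
  · exact integral_lagrangeRight_mul_kern_nonneg hγ₀ hγ₁ hh haligned
  · simp only [zero_mul, intervalIntegral.integral_zero, le_refl]

/-- The product rule `∑_l g_{i,l} w(x_{l/2})` for `∫_a^b w(x) |x_{i/2} - x|^{-γ} dx`. -/
noncomputable def quad (a b γ : ℝ) (M i : ℕ) (w : ℝ → ℝ) : ℝ :=
  ∑ l ∈ Finset.range (2 * M + 1), weight a b γ M i l * w (halfNode a b M l)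

lemma quad_eq_sum_cells (hab : a < b) (hγ₁ : γ < 1) (hM : 1 ≤ M) (i : ℕ) (w : ℝ → ℝ) :
    quad a b γ M i w = ∑ j ∈ Finset.range M,
      ∫ x in node a (step a b M) j..node a (step a b M) j + step a b M,
        quadInterp (node a (step a b M) j) (step a b M) w x * kern γ (halfNode a b M i) x := by
  simp only [quad, weight_eq_sum_cells hab hγ₁ hM, Finset.sum_mul]
  rw [Finset.sum_comm]
  refine Finset.sum_congr rfl fun j hj => ?_
  simp only [← intervalIntegral.integral_mul_const]
  rw [← intervalIntegral.integral_finsetSum fun l _ => ?_]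
  · refine intervalIntegral.integral_congr fun x _ => ?_
    simp only [← sum_cellBasis_mul _ _ (Finset.mem_range.1 hj), Finset.sum_mul]
    exact Finset.sum_congr rfl fun l _ => mul_right_comm _ _ _
  · exact ((intervalIntegrable_kern hγ₁ _ _ _).continuousOn_mul
      (continuous_cellBasis _ _ _ _).continuousOn).mul_const _

lemma sum_weight (hab : a < b) (hγ₁ : γ < 1) (hM : 1 ≤ M) (i : ℕ) :
    ∑ l ∈ Finset.range (2 * M + 1), weight a b γ M i l = diagWeight a b γ M i := by
  have hone := quad_eq_sum_cells hab hγ₁ hM i fun _ => 1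
  simp only [quad, quadInterp, mul_one, one_mul, lagrange_sum (step_pos hab hM).ne'] at hone
  exact hone.trans (integral_eq_sum_cells hM fun j _ => intervalIntegrable_kern hγ₁ _ _ _).symm

lemma diagWeight_nonneg (hab : a ≤ b) (γ : ℝ) (M i : ℕ) : 0 ≤ diagWeight a b γ M i :=
  integral_kern_nonneg γ _ hab

lemma diagWeight_le (hab : a < b) (hγ₁ : γ < 1) (hM : 1 ≤ M) (hi : i ≤ 2 * M) :
    diagWeight a b γ M i ≤ kernBound a b γ :=
  integral_kern_le_kernBound hγ₁ (halfNode_mem_Icc hab hM hi)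

lemma quad_sub (a b γ : ℝ) (M i : ℕ) (v w : ℝ → ℝ) :
    quad a b γ M i v - quad a b γ M i w = quad a b γ M i (v - w) := by
  simp only [quad, Pi.sub_apply, mul_sub, Finset.sum_sub_distrib]

lemma abs_quad_le (hab : a < b) (hγ₀ : 0 ≤ γ) (hγ₁ : γ < 1) (hM : 1 ≤ M) (hi : i ≤ 2 * M)
    {w : ℝ → ℝ} {ε : ℝ} (hw : ∀ x ∈ Icc a b, |w x| ≤ ε) :
    |quad a b γ M i w| ≤ kernBound a b γ * ε := by
  have hε : 0 ≤ ε := (abs_nonneg _).trans (hw a (left_mem_Icc.2 hab.le))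
  calc |quad a b γ M i w| ≤ ∑ l ∈ Finset.range (2 * M + 1), weight a b γ M i l * ε := by
        refine Finset.abs_sum_le_sum_abs _ _ |>.trans (Finset.sum_le_sum fun l hl => ?_)
        have hwt := weight_nonneg hab hγ₀ hγ₁ hM i l
        have hl' : l ≤ 2 * M := Nat.lt_succ_iff.1 (Finset.mem_range.1 hl)
        rw [abs_mul, abs_of_nonneg hwt]
        exact mul_le_mul_of_nonneg_left (hw _ (halfNode_mem_Icc hab hM hl')) hwt
    _ = diagWeight a b γ M i * ε := by rw [← Finset.sum_mul, sum_weight hab hγ₁ hM]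
    _ ≤ kernBound a b γ * ε :=
        mul_le_mul_of_nonneg_right (diagWeight_le hab hγ₁ hM hi) hε

end Weights

/-- `w` is of class `C^n` on `s` and its derivatives of order at most `n` are bounded by `B`. -/
structure BoundedContDiffOn (n : ℕ) (B : ℝ) (w : ℝ → ℝ) (s : Set ℝ) : Prop where
  contDiffOn : ContDiffOn ℝ n w s
  bound : ∀ x ∈ s, ∀ m ≤ n, |iteratedDerivWithin m w s x| ≤ B

namespace BoundedContDiffOn

variable {n : ℕ} {B a b p q x : ℝ} {w : ℝ → ℝ} {s : Set ℝ}

lemma nonneg (hw : BoundedContDiffOn n B w s) (hx : x ∈ s) : 0 ≤ B :=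
  (abs_nonneg _).trans (hw.bound x hx 0 n.zero_le)

lemma of_le {k : ℕ} (hw : BoundedContDiffOn n B w s) (hk : k ≤ n) : BoundedContDiffOn k B w s :=
  ⟨hw.contDiffOn.of_le (by exact_mod_cast hk), fun x hx m hm => hw.bound x hx m (hm.trans hk)⟩

lemma mono_Icc (hw : BoundedContDiffOn n B w (Icc a b)) (hpq : p < q)
    (hsub : Icc p q ⊆ Icc a b) : BoundedContDiffOn n B w (Icc p q) := by
  have hab : a < b :=
    (hsub (left_mem_Icc.2 hpq.le)).1.trans_lt (hpq.trans_le (hsub (right_mem_Icc.2 hpq.le)).2)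
  refine ⟨hw.contDiffOn.mono hsub, fun x hx m hm => ?_⟩
  have heq : iteratedDerivWithin m w (Icc p q) x = iteratedDerivWithin m w (Icc a b) x := by
    unfold iteratedDerivWithin
    rw [iteratedFDerivWithin_subset hsub (uniqueDiffOn_Icc hpq) (uniqueDiffOn_Icc hab)
      (hw.contDiffOn.of_le (by exact_mod_cast hm)) hx]
  exact heq ▸ hw.bound x (hsub hx) m hm

lemma derivWithin (hs : UniqueDiffOn ℝ s) (hw : BoundedContDiffOn (n + 1) B w s) :
    BoundedContDiffOn n B (derivWithin w s) s := by
  refine ⟨hw.contDiffOn.derivWithin hs (by norm_cast), fun x hx m hm => ?_⟩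
  rw [← iteratedDerivWithin_succ']
  exact hw.bound x hx (m + 1) (Nat.succ_le_succ hm)

lemma abs_sub_taylorWithinEval_le (hw : BoundedContDiffOn (n + 1) B w (Icc p q))
    (hx : x ∈ Icc p q) :
    |w x - taylorWithinEval w n (Icc p q) p x| ≤ B * (x - p) ^ (n + 1) / n.factorial :=
  taylor_mean_remainder_bound (hx.1.trans hx.2) (by exact_mod_cast hw.contDiffOn) hx
    fun y hy => hw.bound y hy (n + 1) le_rfl

end BoundedContDiffOn

section InterpolationError

variable {p h B : ℝ} {w : ℝ → ℝ}

-- The cubic Taylor polynomial contributes the multiple of `nodal` to the interpolation error.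
lemma exists_abs_sub_quadInterp_sub_nodal_le (hh : 0 < h)
    (hw : BoundedContDiffOn 4 B w (Icc p (p + h))) :
    ∃ κ, |κ| ≤ B ∧ ∀ x ∈ Icc p (p + h),
      |w x - quadInterp p h w x - κ * nodal p h x| ≤ B * h ^ 4 := by
  have hp : p ∈ Icc p (p + h) := left_mem_Icc.2 (by linarith)
  have hB := hw.nonneg hp
  let D (m : ℕ) : ℝ := iteratedDerivWithin m w (Icc p (p + h)) p
  let P (x : ℝ) : ℝ := D 0 + D 1 * (x - p) + D 2 / 2 * (x - p) ^ 2 + D 3 / 6 * (x - p) ^ 3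
  have hremainder : ∀ x ∈ Icc p (p + h), |(w - P) x| ≤ B * h ^ 4 / 6 := by
    intro x hx
    have htaylor := hw.abs_sub_taylorWithinEval_le hx
    have hP : taylorWithinEval w 3 (Icc p (p + h)) p x = P x := by
      rw [taylor_within_apply]
      simp only [Finset.sum_range_succ, Finset.sum_range_zero, smul_eq_mul, Nat.factorial, P, D]
      push_cast
      ring
    rw [hP] at htaylor
    have hx₀ : 0 ≤ x - p := by linarith [hx.1]
    have hx₁ : x - p ≤ h := by linarith [hx.2]
    calc |(w - P) x| ≤ B * (x - p) ^ 4 / 6 := by simpa [Nat.factorial] using htaylor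
      _ ≤ B * h ^ 4 / 6 := by gcongr
  refine ⟨D 3 / 6, ?_, fun x hx => ?_⟩
  · have hD : |D 3| ≤ B := hw.bound p hp 3 (by norm_num)
    rw [abs_div, abs_of_pos (by norm_num : (0 : ℝ) < 6)]
    linarith [abs_nonneg (D 3)]
  · have hcubic : P x - quadInterp p h P x = D 3 / 6 * nodal p h x :=
      cubic_sub_quadInterp hh.ne' p (D 0) (D 1) (D 2 / 2) (D 3 / 6) x
    have hsplit : w x - quadInterp p h w x - D 3 / 6 * nodal p h x =
        (w - P) x - quadInterp p h (w - P) x := by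
      rw [← hcubic, quadInterp_sub, Pi.sub_apply]
      ring
    calc |w x - quadInterp p h w x - D 3 / 6 * nodal p h x|
        ≤ |(w - P) x| + |quadInterp p h (w - P) x| := hsplit ▸ abs_sub _ _
      _ ≤ B * h ^ 4 / 6 + 3 * (B * h ^ 4 / 6) :=
          add_le_add (hremainder x hx) (abs_quadInterp_le hh hx hremainder)
      _ ≤ B * h ^ 4 := by linarith [show 0 ≤ B * h ^ 4 by positivity]

lemma abs_integral_sub_quadInterp_mul_kern_le {γ X : ℝ} (hγ₀ : 0 ≤ γ) (hγ₁ : γ < 1) (hh : 0 < h)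
    (hX : CellAligned p h X) (hw : BoundedContDiffOn 4 B w (Icc p (p + h))) :
    |∫ x in p..p + h, (w x - quadInterp p h w x) * kern γ X x| ≤
      B * h ^ 3 * |(∫ x in p..p + h / 2, kern γ X x) - ∫ x in p + h / 2..p + h, kern γ X x| +
        B * h ^ 4 * ∫ x in p..p + h, kern γ X x := by
  obtain ⟨κ, hκ, hremainder⟩ := exists_abs_sub_quadInterp_sub_nodal_le hh hw
  have hB := hw.nonneg (left_mem_Icc.2 (by linarith))
  have hwc : ContinuousOn w (uIcc p (p + h)) := by
    rw [uIcc_of_le (by linarith)]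
    exact hw.contDiffOn.continuousOn
  have hsplit : ∫ x in p..p + h, (w x - quadInterp p h w x) * kern γ X x =
      κ * (∫ x in p..p + h, nodal p h x * kern γ X x) +
        ∫ x in p..p + h, (w x - quadInterp p h w x - κ * nodal p h x) * kern γ X x := by
    rw [← intervalIntegral.integral_const_mul, ← intervalIntegral.integral_add
      (((intervalIntegrable_kern hγ₁ _ _ _).continuousOn_mul (by fun_prop)).const_mul κ)
      ((intervalIntegrable_kern hγ₁ _ _ _).continuousOn_mul (by fun_prop))]
    congr with x
    ring
  rw [hsplit]
  refine (abs_add_le _ _).trans (add_le_add ?_ ?_)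
  · rw [abs_mul, mul_assoc]
    exact mul_le_mul hκ (abs_integral_nodal_mul_kern_le hγ₀ hγ₁ hh hX) (abs_nonneg _) hB
  · rw [← intervalIntegral.integral_const_mul]
    refine abs_integral_le_of_abs_le (by linarith)
      ((intervalIntegrable_kern hγ₁ _ _ _).const_mul _) fun x hx => ?_
    rw [abs_mul, abs_of_nonneg (kern_nonneg γ X x)]
    exact mul_le_mul_of_nonneg_right (hremainder x (Ioo_subset_Icc_self hx)) (kern_nonneg γ X x)

end InterpolationError

lemma gridMass_even_sub_gridMass_odd (γ a h : ℝ) (i j : ℕ) :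
    gridMass γ a (h / 2) i (2 * j) - gridMass γ a (h / 2) i (2 * j + 1) =
      (∫ x in node a h j..node a h j + h / 2, kern γ (node a h ((i : ℝ) / 2)) x) -
        ∫ x in node a h j + h / 2..node a h j + h, kern γ (node a h ((i : ℝ) / 2)) x := by
  unfold gridMass
  rw [node_div_two]
  congr 2 <;> unfold node <;> push_cast <;> ring

/-- The constant in the error bound of the product rule `quad`. -/
noncomputable def quadConst (a b γ : ℝ) : ℝ := 2 / (1 - γ) + (b - a) ^ γ * kernBound a b γ

section Quadrature

variable {a b γ B : ℝ} {M i : ℕ}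

lemma quadConst_nonneg (hab : a ≤ b) (hγ₁ : γ < 1) : 0 ≤ quadConst a b γ := by
  have : 0 ≤ b - a := sub_nonneg.2 hab
  have : 0 ≤ 1 - γ := sub_nonneg.2 hγ₁.le
  have hkern := kernBound_nonneg hab hγ₁
  unfold quadConst
  positivity

lemma step_le (hab : a ≤ b) (hM : 1 ≤ M) : step a b M ≤ b - a :=
  div_le_self (sub_nonneg.2 hab) (by exact_mod_cast hM)

lemma powers_le_quadConst_mul {h : ℝ} (hγ₀ : 0 ≤ γ) (hγ₁ : γ < 1) (hB : 0 ≤ B) (hh : 0 < h)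
    (hhab : h ≤ b - a) :
    B * h ^ 3 * (2 * ((h / 2) ^ (1 - γ) / (1 - γ))) + B * h ^ 4 * kernBound a b γ ≤
      quadConst a b γ * B * h ^ (4 - γ) := by
  have : 0 < 1 - γ := sub_pos.2 hγ₁
  have hkern : 0 ≤ kernBound a b γ := kernBound_nonneg (by linarith) hγ₁
  have hhalf : h / 2 ≤ h := half_le_self hh.le
  have hcube : h ^ 3 * h ^ (1 - γ) = h ^ (4 - γ) := by
    rw [← Real.rpow_natCast, ← Real.rpow_add hh]; congr 1; push_cast; ring
  have hfourth : h ^ 4 = h ^ (4 - γ) * h ^ γ := by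
    rw [← Real.rpow_add hh, ← Real.rpow_natCast]; congr 1; push_cast; ring
  calc _ ≤ B * h ^ 3 * (2 * (h ^ (1 - γ) / (1 - γ)))
          + B * (h ^ (4 - γ) * (b - a) ^ γ) * kernBound a b γ := by
        rw [hfourth]; gcongr
    _ = quadConst a b γ * B * h ^ (4 - γ) := by rw [quadConst, ← hcube]; ring

theorem abs_integral_mul_kern_sub_quad_le (hab : a < b) (hγ₀ : 0 ≤ γ) (hγ₁ : γ < 1) (hM : 1 ≤ M)
    (hi : i ≤ 2 * M) {w : ℝ → ℝ} (hw : BoundedContDiffOn 4 B w (Icc a b)) :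
    |(∫ x in a..b, w x * kern γ (halfNode a b M i) x) - quad a b γ M i w| ≤
      quadConst a b γ * B * step a b M ^ (4 - γ) := by
  have hh := step_pos hab hM
  have hB : 0 ≤ B := hw.nonneg (left_mem_Icc.2 hab.le)
  have hcell {j : ℕ} (hj : j < M) := hw.mono_Icc (by linarith) (cell_subset hab hM hj)
  have hIw {j : ℕ} (hj : j < M) : IntervalIntegrable (fun x => w x * kern γ (halfNode a b M i) x)
      volume (node a (step a b M) j) (node a (step a b M) j + step a b M) :=
    (intervalIntegrable_kern hγ₁ _ _ _).continuousOn_mul (by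
      rw [uIcc_of_le (by linarith)]
      exact (hcell hj).contDiffOn.continuousOn)
  have hcellError : ∀ j ∈ Finset.range M,
      |(∫ x in node a (step a b M) j..node a (step a b M) j + step a b M,
          w x * kern γ (halfNode a b M i) x) -
        ∫ x in node a (step a b M) j..node a (step a b M) j + step a b M,
          quadInterp (node a (step a b M) j) (step a b M) w x * kern γ (halfNode a b M i) x| ≤
      B * step a b M ^ 3 * |gridMass γ a (step a b M / 2) i (2 * j) -
          gridMass γ a (step a b M / 2) i (2 * j + 1)| +
        B * step a b M ^ 4 * ∫ x in node a (step a b M) j..node a (step a b M) j + step a b M,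
          kern γ (halfNode a b M i) x := by
    intro j hj
    rw [← intervalIntegral.integral_sub (hIw (Finset.mem_range.1 hj))
      ((intervalIntegrable_kern hγ₁ _ _ _).continuousOn_mul (by fun_prop)),
      gridMass_even_sub_gridMass_odd]
    simp only [← sub_mul]
    exact abs_integral_sub_quadInterp_mul_kern_le hγ₀ hγ₁ hh (cellAligned_node hh a i j)
      (hcell (Finset.mem_range.1 hj))
  rw [quad_eq_sum_cells hab hγ₁ hM, integral_eq_sum_cells hM fun j => hIw,
    ← Finset.sum_sub_distrib]
  refine (Finset.abs_sum_le_sum_abs _ _).trans ((Finset.sum_le_sum hcellError).trans ?_)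
  rw [Finset.sum_add_distrib, ← Finset.mul_sum, ← Finset.mul_sum,
    ← integral_eq_sum_cells hM fun j _ => intervalIntegrable_kern hγ₁ _ _ _]
  refine le_trans ?_ (powers_le_quadConst_mul hγ₀ hγ₁ hB hh (step_le hab.le hM))
  gcongr
  · exact sum_abs_gridMass_sub_le hγ₀ hγ₁ a (half_pos hh) i M
  · exact diagWeight_le hab hγ₁ hM hi

end Quadrature

lemma norm_iteratedFDerivWithin_smul_add_le {E : Type*} [NormedAddCommGroup E] [NormedSpace ℝ E]
    {e : E} (he : ‖e‖ ≤ 1) (z : E) {s : Set ℝ} (hs : UniqueDiffOn ℝ s) {x : ℝ} (hx : x ∈ s) {m : ℕ}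
    (hm : 1 ≤ m) : ‖iteratedFDerivWithin ℝ m (fun x : ℝ => x • e + z) s x‖ ≤ 1 := by
  obtain ⟨k, rfl⟩ := Nat.exists_eq_add_of_le' hm
  have hderiv : EqOn (derivWithin (fun x : ℝ => x • e + z) s) (fun _ => e) s := fun y hy => by
    simpa using (((hasDerivAt_id y).smul_const e).add_const z).hasDerivWithinAt.derivWithin
      (hs y hy)
  rw [norm_iteratedFDerivWithin_eq_norm_iteratedDerivWithin, iteratedDerivWithin_succ',
    iteratedDerivWithin_congr hderiv hx, iteratedDerivWithin_const]
  split_ifs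
  · exact he
  · simp

lemma BoundedContDiffOn.comp_line {E : Type*} [NormedAddCommGroup E] [NormedSpace ℝ E]
    {F : E → ℝ} {S : Set E} {s : Set ℝ} {n : ℕ} {B : ℝ} (hF : ContDiffOn ℝ n F S)
    (hB : ∀ p ∈ S, ∀ m ≤ n, ‖iteratedFDerivWithin ℝ m F S p‖ ≤ B) (hS : UniqueDiffOn ℝ S)
    (hs : UniqueDiffOn ℝ s) {e : E} (he : ‖e‖ ≤ 1) (z : E)
    (hmaps : MapsTo (fun x : ℝ => x • e + z) s S) :
    BoundedContDiffOn n (n.factorial * B) (fun x => F (x • e + z)) s := by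
  have hline : ContDiffOn ℝ n (fun x : ℝ => x • e + z) s := by fun_prop
  refine ⟨hF.comp hline hmaps, fun x hx m hm => ?_⟩
  have hB₀ : 0 ≤ B := (norm_nonneg _).trans (hB _ (hmaps hx) 0 n.zero_le)
  have hcomp := norm_iteratedFDerivWithin_comp_le hF hline (by exact_mod_cast hm) hS hs hmaps hx
    (C := B) (D := 1) (fun k hk => hB _ (hmaps hx) k (hk.trans hm)) fun k hk _ => by
      rw [one_pow]
      exact norm_iteratedFDerivWithin_smul_add_le he z hs hx hk
  rw [one_pow, mul_one, norm_iteratedFDerivWithin_eq_norm_iteratedDerivWithin] at hcomp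
  refine hcomp.trans ?_
  gcongr

/-- `v` is continuous on `[a, b] × [c, d]` and of class `C^4` along either coordinate direction,
with derivatives of order at most four bounded by `B`. Nothing is asked of mixed derivatives. -/
structure IsSlicewiseC4 (a b c d B : ℝ) (v : ℝ → ℝ → ℝ) : Prop where
  continuousOn : ContinuousOn (fun p : ℝ × ℝ => v p.1 p.2) (Icc a b ×ˢ Icc c d)
  fst : ∀ y ∈ Icc c d, BoundedContDiffOn 4 B (fun x => v x y) (Icc a b)
  snd : ∀ x ∈ Icc a b, BoundedContDiffOn 4 B (fun y => v x y) (Icc c d)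

namespace IsSlicewiseC4

variable {a b c d B : ℝ} {v : ℝ → ℝ → ℝ}

lemma nonneg (hv : IsSlicewiseC4 a b c d B v) (hab : a ≤ b) (hcd : c ≤ d) : 0 ≤ B :=
  (hv.fst c (left_mem_Icc.2 hcd)).nonneg (left_mem_Icc.2 hab)

lemma continuousOn_snd (hv : IsSlicewiseC4 a b c d B v) :
    ∀ x ∈ Icc a b, ContinuousOn (v x) (Icc c d) :=
  fun x hx => (hv.snd x hx).contDiffOn.continuousOn

end IsSlicewiseC4

section Rectangle

variable {a b c d γ B : ℝ} {v : ℝ → ℝ → ℝ}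

lemma isSlicewiseC4_of_contDiffOn (hab : a < b) (hcd : c < d)
    (hv : ContDiffOn ℝ 4 (fun p : ℝ × ℝ => v p.1 p.2) (Icc a b ×ˢ Icc c d))
    (hB : ∀ p ∈ Icc a b ×ˢ Icc c d, ∀ m ≤ 4, ‖iteratedFDerivWithin ℝ m
      (fun q : ℝ × ℝ => v q.1 q.2) (Icc a b ×ˢ Icc c d) p‖ ≤ B) :
    IsSlicewiseC4 a b c d ((4).factorial * B) v where
  continuousOn := hv.continuousOn
  fst y hy := by
    simpa using BoundedContDiffOn.comp_line (n := 4) hv hB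
      ((uniqueDiffOn_Icc hab).prod (uniqueDiffOn_Icc hcd)) (uniqueDiffOn_Icc hab)
      (e := (1, 0)) (by simp) (0, y) fun x hx => by
        simpa [-Icc_prod_Icc] using And.intro hx hy
  snd x hx := by
    simpa using BoundedContDiffOn.comp_line (n := 4) hv hB
      ((uniqueDiffOn_Icc hab).prod (uniqueDiffOn_Icc hcd)) (uniqueDiffOn_Icc hcd)
      (e := (0, 1)) (by simp) (x, 0) fun y hy => by
        simpa [-Icc_prod_Icc] using And.intro hx hy

lemma integrable_mul_kern_prod (hγ₁ : γ < 1) (hab : a ≤ b) (hcd : c ≤ d) (X Y : ℝ)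
    (hv : ContinuousOn (fun p : ℝ × ℝ => v p.1 p.2) (Icc a b ×ˢ Icc c d)) :
    Integrable (fun p : ℝ × ℝ => v p.1 p.2 * (kern γ X p.1 * kern γ Y p.2))
      ((volume.restrict (Ioo a b)).prod (volume.restrict (Ioo c d))) := by
  have hkern : IntegrableOn (fun p : ℝ × ℝ => kern γ X p.1 * kern γ Y p.2)
      (Icc a b ×ˢ Icc c d) := by
    rw [IntegrableOn, Measure.volume_eq_prod, ← Measure.prod_restrict]
    exact Integrable.mul_prod
      ((intervalIntegrable_iff_integrableOn_Icc_of_le hab).1 (intervalIntegrable_kern hγ₁ X a b))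
      ((intervalIntegrable_iff_integrableOn_Icc_of_le hcd).1 (intervalIntegrable_kern hγ₁ Y c d))
  rw [Measure.prod_restrict, ← Measure.volume_eq_prod]
  exact (hkern.continuousOn_mul hv (isCompact_Icc.prod isCompact_Icc)).mono_set
    (prod_mono Ioo_subset_Icc_self Ioo_subset_Icc_self)

lemma setIntegral_Ioo_mul_kern_prod (hab : a ≤ b) (X Y y : ℝ) :
    ∫ x in Ioo a b, v x y * (kern γ X x * kern γ Y y) =
      (∫ x in a..b, v x y * kern γ X x) * kern γ Y y := by
  simp only [← mul_assoc]
  rw [integral_mul_const, ← integral_Ioc_eq_integral_Ioo, intervalIntegral.integral_of_le hab]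

lemma setIntegral_mul_kern_prod (hγ₁ : γ < 1) (hab : a ≤ b) (hcd : c ≤ d) (X Y : ℝ)
    (hv : ContinuousOn (fun p : ℝ × ℝ => v p.1 p.2) (Icc a b ×ˢ Icc c d)) :
    ∫ p in Ioo a b ×ˢ Ioo c d, v p.1 p.2 * (kern γ X p.1 * kern γ Y p.2) =
      ∫ y in c..d, (∫ x in a..b, v x y * kern γ X x) * kern γ Y y := by
  rw [Measure.volume_eq_prod, ← Measure.prod_restrict,
    integral_prod_symm _ (integrable_mul_kern_prod hγ₁ hab hcd X Y hv),
    intervalIntegral.integral_of_le hcd, integral_Ioc_eq_integral_Ioo]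
  simp only [setIntegral_Ioo_mul_kern_prod hab]

lemma intervalIntegrable_integral_mul_kern (hγ₁ : γ < 1) (hab : a ≤ b) (hcd : c ≤ d) (X Y : ℝ)
    (hv : ContinuousOn (fun p : ℝ × ℝ => v p.1 p.2) (Icc a b ×ˢ Icc c d)) :
    IntervalIntegrable (fun y => (∫ x in a..b, v x y * kern γ X x) * kern γ Y y) volume c d := by
  rw [intervalIntegrable_iff_integrableOn_Ioo_of_le hcd, IntegrableOn]
  simpa only [setIntegral_Ioo_mul_kern_prod hab] using
    (integrable_mul_kern_prod hγ₁ hab hcd X Y hv).integral_prod_right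

lemma nonlocalOp_eq (hγ₁ : γ < 1) (hab : a ≤ b) (hcd : c ≤ d) (X Y : ℝ)
    (hv : ContinuousOn (fun p : ℝ × ℝ => v p.1 p.2) (Icc a b ×ˢ Icc c d)) :
    nonlocalOp a b c d γ v X Y =
      (∫ x in a..b, kern γ X x) * (∫ y in c..d, kern γ Y y) * v X Y -
        ∫ y in c..d, (∫ x in a..b, v x y * kern γ X x) * kern γ Y y := by
  have hsplit (p : ℝ × ℝ) : (v X Y - v p.1 p.2) / (|X - p.1| ^ γ * |Y - p.2| ^ γ) =
      v X Y * (kern γ X p.1 * kern γ Y p.2) - v p.1 p.2 * (kern γ X p.1 * kern γ Y p.2) := by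
    rw [← sub_mul, kern, kern, div_mul_div_comm, one_mul, mul_one_div]
  have hint {w : ℝ → ℝ → ℝ}
      (hw : ContinuousOn (fun p : ℝ × ℝ => w p.1 p.2) (Icc a b ×ˢ Icc c d)) :
      IntegrableOn (fun p : ℝ × ℝ => w p.1 p.2 * (kern γ X p.1 * kern γ Y p.2))
        (Ioo a b ×ˢ Ioo c d) := by
    rw [IntegrableOn, Measure.volume_eq_prod, ← Measure.prod_restrict]
    exact integrable_mul_kern_prod hγ₁ hab hcd X Y hw
  have hconst := setIntegral_mul_kern_prod (v := fun _ _ => v X Y) hγ₁ hab hcd X Y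
    continuousOn_const
  unfold nonlocalOp
  simp only [hsplit]
  rw [integral_sub (hint (w := fun _ _ => v X Y) continuousOn_const) (hint hv),
    setIntegral_mul_kern_prod hγ₁ hab hcd X Y hv, hconst]
  simp only [intervalIntegral.integral_const_mul]
  ring

variable {Mx My i j : ℕ}

lemma intervalIntegrable_quad_mul_kern (hab : a < b) (hcd : c ≤ d) (hγ₁ : γ < 1) (hMx : 1 ≤ Mx)
    (i : ℕ) (Y : ℝ) (hv : ∀ x ∈ Icc a b, ContinuousOn (v x) (Icc c d)) :
    IntervalIntegrable (fun y => quad a b γ Mx i (fun x => v x y) * kern γ Y y) volume c d := by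
  refine (intervalIntegrable_kern hγ₁ _ _ _).continuousOn_mul ?_
  rw [uIcc_of_le hcd]
  exact continuousOn_finsetSum _ fun l hl =>
    (hv _ (halfNode_mem_Icc hab hMx (Nat.lt_succ_iff.1 (Finset.mem_range.1 hl)))).const_mul _

lemma integral_quad_mul_kern (hab : a < b) (hcd : c ≤ d) (hγ₁ : γ < 1) (hMx : 1 ≤ Mx) (i : ℕ)
    (Y : ℝ) (hv : ∀ x ∈ Icc a b, ContinuousOn (v x) (Icc c d)) :
    ∫ y in c..d, quad a b γ Mx i (fun x => v x y) * kern γ Y y =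
      quad a b γ Mx i fun x => ∫ y in c..d, v x y * kern γ Y y := by
  simp only [quad, Finset.sum_mul, mul_assoc]
  rw [intervalIntegral.integral_finsetSum fun l hl => ?_]
  · simp only [intervalIntegral.integral_const_mul]
  · refine ((intervalIntegrable_kern hγ₁ _ _ _).continuousOn_mul ?_).const_mul _
    rw [uIcc_of_le hcd]
    exact hv _ (halfNode_mem_Icc hab hMx (Nat.lt_succ_iff.1 (Finset.mem_range.1 hl)))

lemma abs_integral_integral_sub_quad_mul_kern_le (hab : a < b) (hcd : c < d) (hγ₀ : 0 ≤ γ)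
    (hγ₁ : γ < 1) (hMx : 1 ≤ Mx) (hMy : 1 ≤ My) (hi : i ≤ 2 * Mx) (hj : j ≤ 2 * My)
    (hv : IsSlicewiseC4 a b c d B v) :
    |(∫ y in c..d, (∫ x in a..b, v x y * kern γ (halfNode a b Mx i) x) *
        kern γ (halfNode c d My j) y) -
      ∫ y in c..d, quad a b γ Mx i (fun x => v x y) * kern γ (halfNode c d My j) y| ≤
      quadConst a b γ * B * step a b Mx ^ (4 - γ) * kernBound c d γ := by
  have hB : 0 ≤ B := hv.nonneg hab.le hcd.le
  rw [← intervalIntegral.integral_sub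
    (intervalIntegrable_integral_mul_kern hγ₁ hab.le hcd.le _ _ hv.continuousOn)
    (intervalIntegrable_quad_mul_kern hab hcd.le hγ₁ hMx i _ hv.continuousOn_snd)]
  simp only [← sub_mul]
  refine (abs_integral_le_of_abs_le hcd.le
    ((intervalIntegrable_kern hγ₁ (halfNode c d My j) c d).const_mul
      (quadConst a b γ * B * step a b Mx ^ (4 - γ))) fun y hy => ?_).trans ?_
  · rw [abs_mul, abs_of_nonneg (kern_nonneg _ _ _)]
    exact mul_le_mul_of_nonneg_right (abs_integral_mul_kern_sub_quad_le hab hγ₀ hγ₁ hMx hi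
      (hv.fst y (Ioo_subset_Icc_self hy))) (kern_nonneg _ _ _)
  · rw [intervalIntegral.integral_const_mul]
    exact mul_le_mul_of_nonneg_left (diagWeight_le hcd hγ₁ hMy hj)
      (mul_nonneg (mul_nonneg (quadConst_nonneg hab.le hγ₁) hB)
        (Real.rpow_nonneg (step_pos hab hMx).le _))

/-- The constant in the error bound for the tensor product quadrature: each term is the error
of one direction times the total mass of the kernel in the other. -/
noncomputable def spaceConst (a b c d γ : ℝ) : ℝ :=
  quadConst a b γ * kernBound c d γ + kernBound a b γ * quadConst c d γ

lemma spaceConst_nonneg (hab : a ≤ b) (hcd : c ≤ d) (hγ₁ : γ < 1) : 0 ≤ spaceConst a b c d γ :=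
  add_nonneg (mul_nonneg (quadConst_nonneg hab hγ₁) (kernBound_nonneg hcd hγ₁))
    (mul_nonneg (kernBound_nonneg hab hγ₁) (quadConst_nonneg hcd hγ₁))

theorem abs_integral_integral_sub_quad_quad_le (hab : a < b) (hcd : c < d) (hγ₀ : 0 ≤ γ)
    (hγ₁ : γ < 1) (hMx : 1 ≤ Mx) (hMy : 1 ≤ My) (hi : i ≤ 2 * Mx) (hj : j ≤ 2 * My)
    (hv : IsSlicewiseC4 a b c d B v) :
    |(∫ y in c..d, (∫ x in a..b, v x y * kern γ (halfNode a b Mx i) x) *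
        kern γ (halfNode c d My j) y) -
      quad a b γ Mx i fun x => quad c d γ My j (v x)| ≤
      spaceConst a b c d γ * B * (step a b Mx ^ (4 - γ) + step c d My ^ (4 - γ)) := by
  have hx := abs_integral_integral_sub_quad_mul_kern_le hab hcd hγ₀ hγ₁ hMx hMy hi hj hv
  have hy : |(∫ y in c..d, quad a b γ Mx i (fun x => v x y) * kern γ (halfNode c d My j) y) -
      quad a b γ Mx i fun x => quad c d γ My j (v x)| ≤
      kernBound a b γ * (quadConst c d γ * B * step c d My ^ (4 - γ)) := by
    rw [integral_quad_mul_kern hab hcd.le hγ₁ hMx i _ hv.continuousOn_snd, quad_sub]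
    exact abs_quad_le hab hγ₀ hγ₁ hMx hi fun x hx =>
      abs_integral_mul_kern_sub_quad_le hcd hγ₀ hγ₁ hMy hj (hv.snd x hx)
  have hB : 0 ≤ B := hv.nonneg hab.le hcd.le
  have hcrossx : 0 ≤ quadConst a b γ * kernBound c d γ * B * step c d My ^ (4 - γ) :=
    mul_nonneg (mul_nonneg (mul_nonneg (quadConst_nonneg hab.le hγ₁)
      (kernBound_nonneg hcd.le hγ₁)) hB) (Real.rpow_nonneg (step_pos hcd hMy).le _)
  have hcrossy : 0 ≤ kernBound a b γ * quadConst c d γ * B * step a b Mx ^ (4 - γ) :=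
    mul_nonneg (mul_nonneg (mul_nonneg (kernBound_nonneg hab.le hγ₁)
      (quadConst_nonneg hcd.le hγ₁)) hB) (Real.rpow_nonneg (step_pos hab hMx).le _)
  refine (abs_sub_le _ _ _).trans ((add_le_add hx hy).trans ?_)
  unfold spaceConst
  linarith

end Rectangle

section RowDominant

variable {ι : Type*} [Fintype ι] [DecidableEq ι] {A : Matrix ι ι ℝ} {θ K : ℝ}

/-- Weak diagonal dominance by rows, with a nonnegative diagonal. -/
def RowDominant (A : Matrix ι ι ℝ) : Prop :=
  ∀ i, ∑ j ∈ Finset.univ.erase i, |A i j| ≤ A i i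

lemma RowDominant.diag_nonneg (hA : RowDominant A) (i : ι) : 0 ≤ A i i :=
  (Finset.sum_nonneg fun _ _ => abs_nonneg _).trans (hA i)

lemma RowDominant.abs_mulVec_sub_le (hA : RowDominant A) (s : ι → ℝ) (i : ι) :
    |A.mulVec s i - A i i * s i| ≤ A i i * ‖s‖ := by
  have hoff : A.mulVec s i - A i i * s i = ∑ j ∈ Finset.univ.erase i, A i j * s j := by
    rw [Matrix.mulVec, dotProduct, ← Finset.add_sum_erase _ _ (Finset.mem_univ i),
      add_sub_cancel_left]
  calc |A.mulVec s i - A i i * s i| ≤ ∑ j ∈ Finset.univ.erase i, |A i j| * ‖s‖ := by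
        rw [hoff]
        refine (Finset.abs_sum_le_sum_abs _ _).trans (Finset.sum_le_sum fun j _ => ?_)
        rw [abs_mul]
        exact mul_le_mul_of_nonneg_left (norm_le_pi_norm s j) (abs_nonneg _)
    _ ≤ A i i * ‖s‖ := by
        rw [← Finset.sum_mul]
        exact mul_le_mul_of_nonneg_right (hA i) (norm_nonneg s)

lemma RowDominant.norm_mulVec_le (hA : RowDominant A) (hK₀ : 0 ≤ K) (hK : ∀ i, A i i ≤ K)
    (s : ι → ℝ) : ‖A.mulVec s‖ ≤ 2 * K * ‖s‖ := by
  refine (pi_norm_le_iff_of_nonneg (by positivity)).2 fun i => ?_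
  have hdiag : |A i i * s i| ≤ K * ‖s‖ := by
    rw [abs_mul, abs_of_nonneg (hA.diag_nonneg i)]
    exact mul_le_mul (hK i) (norm_le_pi_norm s i) (abs_nonneg _) hK₀
  calc |A.mulVec s i| ≤ |A.mulVec s i - A i i * s i| + |A i i * s i| := by
        simpa using abs_add_le (A.mulVec s i - A i i * s i) (A i i * s i)
    _ ≤ K * ‖s‖ + K * ‖s‖ := add_le_add ((hA.abs_mulVec_sub_le s i).trans
        (mul_le_mul_of_nonneg_right (hK i) (norm_nonneg s))) hdiag
    _ = 2 * K * ‖s‖ := by ring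

lemma RowDominant.norm_le_norm_one_add_smul_mulVec (hA : RowDominant A) (hθ : 0 ≤ θ) (s : ι → ℝ) :
    ‖s‖ ≤ ‖(1 + θ • A).mulVec s‖ := by
  cases isEmpty_or_nonempty ι
  · simp [Subsingleton.elim s 0]
  obtain ⟨i, hi⟩ := Finite.exists_max fun i => |s i|
  have hs : ‖s‖ = |s i| :=
    le_antisymm ((pi_norm_le_iff_of_nonneg (abs_nonneg _)).2 hi) (norm_le_pi_norm s i)
  have hdiag : 0 ≤ θ * A i i := mul_nonneg hθ (hA.diag_nonneg i)
  have hoff : |θ * (A i i * s i - A.mulVec s i)| ≤ θ * A i i * |s i| := by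
    rw [abs_mul, abs_of_nonneg hθ, abs_sub_comm, mul_assoc, ← hs]
    exact mul_le_mul_of_nonneg_left (hA.abs_mulVec_sub_le s i) hθ
  calc ‖s‖ = |(1 + θ * A i i) * s i| - θ * A i i * |s i| := by
        rw [abs_mul, abs_of_nonneg (by positivity), hs]
        ring
    _ ≤ |(1 + θ * A i i) * s i| - |θ * (A i i * s i - A.mulVec s i)| := by linarith
    _ ≤ |(1 + θ * A i i) * s i - θ * (A i i * s i - A.mulVec s i)| :=
        abs_sub_abs_le_abs_sub _ _
    _ = ‖(1 + θ • A).mulVec s i‖ := by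
        rw [Matrix.add_mulVec, Matrix.one_mulVec, Matrix.smul_mulVec, Pi.add_apply, Pi.smul_apply,
          smul_eq_mul, Real.norm_eq_abs]
        ring_nf
    _ ≤ ‖(1 + θ • A).mulVec s‖ := norm_le_pi_norm _ i

lemma RowDominant.bijective_one_add_smul_mulVec (hA : RowDominant A) (hθ : 0 ≤ θ) :
    Function.Bijective (1 + θ • A).mulVec := by
  have hinj : Function.Injective (1 + θ • A).mulVecLin := by
    refine (injective_iff_map_eq_zero _).2 fun s hs => norm_le_zero_iff.1 ?_
    simpa [Matrix.mulVecLin_apply _ s ▸ hs] using hA.norm_le_norm_one_add_smul_mulVec hθ s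
  exact ⟨hinj, LinearMap.injective_iff_surjective.1 hinj⟩

lemma rowDominant_diagonal_sub {D : ι → ℝ} {G : Matrix ι ι ℝ} (hG : ∀ i j, 0 ≤ G i j)
    (hsum : ∀ i, ∑ j, G i j ≤ D i) : RowDominant (Matrix.diagonal D - G) := fun i => by
  have hoff : ∑ j ∈ Finset.univ.erase i, |(Matrix.diagonal D - G) i j| =
      ∑ j ∈ Finset.univ.erase i, G i j := Finset.sum_congr rfl fun j hj => by
    rw [Matrix.sub_apply, Matrix.diagonal_apply_ne' _ (Finset.ne_of_mem_erase hj), zero_sub,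
      abs_neg, abs_of_nonneg (hG i j)]
  rw [hoff, Matrix.sub_apply, Matrix.diagonal_apply_eq, le_sub_iff_add_le,
    Finset.sum_erase_add _ _ (Finset.mem_univ i)]
  exact hsum i

end RowDominant

lemma sum_fin_succ_eq_sum_Icc (f : ℕ → ℝ) (n : ℕ) :
    ∑ i : Fin n, f (i + 1) = ∑ l ∈ Finset.Icc 1 n, f l := by
  rw [Fin.sum_univ_eq_sum_range (fun l => f (l + 1)) n, Finset.range_eq_Ico,
    Finset.sum_Ico_add' f 0 n 1]
  rfl

lemma sum_range_eq_add_sum_Icc_add (f : ℕ → ℝ) {n : ℕ} (hn : 1 ≤ n) :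
    ∑ l ∈ Finset.range (n + 1), f l = f 0 + ∑ l ∈ Finset.Icc 1 (n - 1), f l + f n := by
  obtain ⟨k, rfl⟩ := Nat.exists_eq_add_of_le' hn
  rw [Finset.sum_range_succ, Finset.sum_range_succ', Nat.add_sub_cancel,
    ← sum_fin_succ_eq_sum_Icc, Fin.sum_univ_eq_sum_range (fun l => f (l + 1)) k]
  ring

section Stability

variable {a b c d γ : ℝ} {M Mx My : ℕ}

lemma sum_matG_le_diagWeight (hab : a < b) (hγ₀ : 0 ≤ γ) (hγ₁ : γ < 1) (hM : 1 ≤ M)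
    (i : Fin (2 * M - 1)) : ∑ l, matG a b γ M i l ≤ diagWeight a b γ M (i + 1) := by
  simp only [matG, Matrix.of_apply]
  rw [sum_fin_succ_eq_sum_Icc (weight a b γ M (i + 1)), ← sum_weight hab hγ₁ hM,
    sum_range_eq_add_sum_Icc_add _ (by omega)]
  linarith [weight_nonneg hab hγ₀ hγ₁ hM (i + 1) 0, weight_nonneg hab hγ₀ hγ₁ hM (i + 1) (2 * M)]

lemma matG_nonneg (hab : a < b) (hγ₀ : 0 ≤ γ) (hγ₁ : γ < 1) (hM : 1 ≤ M)
    (i l : Fin (2 * M - 1)) : 0 ≤ matG a b γ M i l :=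
  weight_nonneg hab hγ₀ hγ₁ hM _ _

lemma matA_eq_diagonal_sub (a b c d γ : ℝ) (Mx My : ℕ) :
    matA a b c d γ Mx My = Matrix.diagonal (fun p : Grid Mx My =>
      diagWeight a b γ Mx (p.1 + 1) * diagWeight c d γ My (p.2 + 1)) -
        matG a b γ Mx ⊗ₖ matG c d γ My := by
  rw [matA, matD, matD, Matrix.diagonal_kronecker_diagonal]

lemma rowDominant_matA (hab : a < b) (hcd : c < d) (hγ₀ : 0 ≤ γ) (hγ₁ : γ < 1) (hMx : 1 ≤ Mx)
    (hMy : 1 ≤ My) : RowDominant (matA a b c d γ Mx My) := by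
  rw [matA_eq_diagonal_sub]
  refine rowDominant_diagonal_sub (fun p q => mul_nonneg (matG_nonneg hab hγ₀ hγ₁ hMx _ _)
    (matG_nonneg hcd hγ₀ hγ₁ hMy _ _)) fun p => ?_
  simp only [Fintype.sum_prod_type, Matrix.kroneckerMap_apply, ← Finset.mul_sum, ← Finset.sum_mul]
  exact mul_le_mul (sum_matG_le_diagWeight hab hγ₀ hγ₁ hMx p.1)
    (sum_matG_le_diagWeight hcd hγ₀ hγ₁ hMy p.2)
    (Finset.sum_nonneg fun l _ => matG_nonneg hcd hγ₀ hγ₁ hMy p.2 l)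
    (diagWeight_nonneg hab.le _ _ _)

lemma matA_diag_le (hab : a < b) (hcd : c < d) (hγ₀ : 0 ≤ γ) (hγ₁ : γ < 1) (hMx : 1 ≤ Mx)
    (hMy : 1 ≤ My) (p : Grid Mx My) :
    matA a b c d γ Mx My p p ≤ kernBound a b γ * kernBound c d γ := by
  rw [matA_eq_diagonal_sub, Matrix.sub_apply, Matrix.diagonal_apply_eq, Matrix.kronecker_apply]
  refine (sub_le_self _ (mul_nonneg (matG_nonneg hab hγ₀ hγ₁ hMx _ _)
    (matG_nonneg hcd hγ₀ hγ₁ hMy _ _))).trans ?_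
  exact mul_le_mul (diagWeight_le hab hγ₁ hMx (by omega)) (diagWeight_le hcd hγ₁ hMy (by omega))
    (diagWeight_nonneg hcd.le _ _ _) (kernBound_nonneg hab.le hγ₁)

end Stability

lemma existsUnique_implicit_recursion {α β : Type*} {L : α → β} (hL : Function.Bijective L)
    (x₀ : α) (R : ℕ → α → β) (N : ℕ) :
    ∃! U : Fin (N + 1) → α, U 0 = x₀ ∧ ∀ k : Fin N, L (U k.succ) = R k (U k.castSucc) := by
  obtain ⟨inv, -, hinv⟩ := Function.bijective_iff_has_inverse.1 hL
  let V : ℕ → α := fun n => Nat.rec x₀ (fun k x => inv (R k x)) n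
  refine ⟨fun k => V k, ⟨rfl, fun k => hinv (R k (V k))⟩, fun W ⟨hW₀, hW⟩ => funext fun k => ?_⟩
  induction k using Fin.induction with
  | zero => exact hW₀
  | succ k ih =>
    refine hL.injective ((hW k).trans ?_)
    rw [ih]
    exact (hinv (R k (V k))).symm

theorem existsUnique_isSchemeSolution {a b c d γ τ : ℝ} {Mx My : ℕ} (hab : a < b) (hcd : c < d)
    (hγ₀ : 0 ≤ γ) (hγ₁ : γ < 1) (hMx : 1 ≤ Mx) (hMy : 1 ≤ My) (hτ : 0 ≤ τ) (N : ℕ)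
    (f g : ℝ → ℝ → ℝ → ℝ) (u₀ : ℝ → ℝ → ℝ) :
    ∃! U : Fin (N + 1) → Grid Mx My → ℝ, IsSchemeSolution a b c d γ τ Mx My N f g u₀ U :=
  existsUnique_implicit_recursion
    ((rowDominant_matA hab hcd hγ₀ hγ₁ hMx hMy).bijective_one_add_smul_mulVec (by positivity))
    (sample a b c d Mx My u₀)
    (fun k s => (1 - (τ / 2) • matA a b c d γ Mx My).mulVec s
      + τ • sample a b c d Mx My (fun x y => f x y (((k : ℝ) + 1 / 2) * τ))
      + τ • bdryVec a b c d γ Mx My (fun x y => g x y (((k : ℝ) + 1 / 2) * τ))) N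

section Consistency

variable {a b c d γ B : ℝ} {Mx My : ℕ} {v g : ℝ → ℝ → ℝ}

lemma matA_mulVec_sample_sub_bdryVec (hMx : 1 ≤ Mx) (hMy : 1 ≤ My) (v : ℝ → ℝ → ℝ)
    (p : Grid Mx My) :
    (matA a b c d γ Mx My).mulVec (sample a b c d Mx My v) p - bdryVec a b c d γ Mx My v p =
      diagWeight a b γ Mx (p.1 + 1) * diagWeight c d γ My (p.2 + 1) * sample a b c d Mx My v p -
        quad a b γ Mx (p.1 + 1) fun x => quad c d γ My (p.2 + 1) (v x) := by
  have hinterior : (matG a b γ Mx ⊗ₖ matG c d γ My).mulVec (sample a b c d Mx My v) p =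
      ∑ l ∈ Finset.Icc 1 (2 * Mx - 1), ∑ r ∈ Finset.Icc 1 (2 * My - 1),
        weight a b γ Mx (p.1 + 1) l * weight c d γ My (p.2 + 1) r *
          v (halfNode a b Mx l) (halfNode c d My r) := by
    rw [Matrix.mulVec, dotProduct, Fintype.sum_prod_type, ← sum_fin_succ_eq_sum_Icc]
    refine Finset.sum_congr rfl fun l _ => ?_
    rw [← sum_fin_succ_eq_sum_Icc]
    rfl
  rw [matA_eq_diagonal_sub, Matrix.sub_mulVec, Pi.sub_apply, Matrix.mulVec_diagonal, hinterior,
    quad, sum_range_eq_add_sum_Icc_add _ (by omega)]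
  simp only [quad, bdryVec, ← Nat.range_succ_eq_Icc_zero,
    sum_range_eq_add_sum_Icc_add _ (by omega : 1 ≤ 2 * My), Finset.sum_add_distrib, mul_add,
    Finset.mul_sum, mul_assoc]
  ring

lemma bdryVec_congr (hab : a < b) (hcd : c < d) (hMx : 1 ≤ Mx) (hMy : 1 ≤ My)
    (hvg : ∀ p ∈ (Icc a b ×ˢ Icc c d) \ (Ioo a b ×ˢ Ioo c d), v p.1 p.2 = g p.1 p.2) :
    bdryVec a b c d γ Mx My v = bdryVec a b c d γ Mx My g := by
  have hboundary {x y : ℝ} (hx : x ∈ Icc a b) (hy : y ∈ Icc c d)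
      (hxy : x = a ∨ x = b ∨ y = c ∨ y = d) : v x y = g x y :=
    hvg (x, y) ⟨⟨hx, hy⟩, fun hmem => by
      rcases hxy with rfl | rfl | rfl | rfl
      exacts [hmem.1.1.false, hmem.1.2.false, hmem.2.1.false, hmem.2.2.false]⟩
  have hx {l : ℕ} (hl : l ≤ 2 * Mx) := halfNode_mem_Icc hab hMx hl
  have hy {r : ℕ} (hr : r ≤ 2 * My) := halfNode_mem_Icc hcd hMy hr
  funext p
  unfold bdryVec
  refine congr_arg₂ _ (congr_arg₂ _ (congr_arg₂ _ ?_ ?_) ?_) ?_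
  · exact congr_arg _ (Finset.sum_congr rfl fun r hr => congr_arg _ (hboundary (hx (by simp))
      (hy (Finset.mem_Icc.1 hr).2) (.inl (halfNode_zero a b Mx))))
  · exact congr_arg _ (Finset.sum_congr rfl fun r hr => congr_arg _ (hboundary (hx le_rfl)
      (hy (Finset.mem_Icc.1 hr).2) (.inr (.inl (halfNode_last a b hMx)))))
  · exact Finset.sum_congr rfl fun l hl => congr_arg _ (hboundary
      (hx ((Finset.mem_Icc.1 hl).2.trans (Nat.sub_le _ _))) (hy (by simp))
      (.inr (.inr (.inl (halfNode_zero c d My)))))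
  · exact Finset.sum_congr rfl fun l hl => congr_arg _ (hboundary
      (hx ((Finset.mem_Icc.1 hl).2.trans (Nat.sub_le _ _))) (hy le_rfl)
      (.inr (.inr (.inr (halfNode_last c d hMy)))))

theorem norm_matA_mulVec_sample_sub_bdryVec_sub_nonlocalOp_le (hab : a < b) (hcd : c < d)
    (hγ₀ : 0 ≤ γ) (hγ₁ : γ < 1) (hMx : 1 ≤ Mx) (hMy : 1 ≤ My) (hv : IsSlicewiseC4 a b c d B v) :
    ‖(matA a b c d γ Mx My).mulVec (sample a b c d Mx My v) - bdryVec a b c d γ Mx My v -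
      sample a b c d Mx My (nonlocalOp a b c d γ v)‖ ≤
      spaceConst a b c d γ * B * (step a b Mx ^ (4 - γ) + step c d My ^ (4 - γ)) := by
  have : Nonempty (Grid Mx My) := ⟨⟨⟨0, by omega⟩, ⟨0, by omega⟩⟩⟩
  refine (pi_norm_le_iff_of_nonempty _).2 fun p => ?_
  refine le_of_eq_of_le (congr_arg abs ?_) (abs_integral_integral_sub_quad_quad_le hab
    hcd hγ₀ hγ₁ hMx hMy (i := p.1 + 1) (j := p.2 + 1) (by omega) (by omega) hv)
  rw [Pi.sub_apply, Pi.sub_apply, matA_mulVec_sample_sub_bdryVec hMx hMy]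
  simp only [sample, nonlocalOp_eq hγ₁ hab.le hcd.le _ _ hv.continuousOn]
  exact sub_sub_sub_cancel_left _ _ _

end Consistency

section Midpoint

variable {z : ℝ → ℝ} {t τ z' B : ℝ}

lemma abs_sub_sub_mul_deriv_midpoint_le (hτ : 0 < τ)
    (hz : BoundedContDiffOn 3 B z (Icc t (t + τ)))
    (hz' : HasDerivWithinAt z z' (Icc t (t + τ)) (t + τ / 2)) :
    |z (t + τ) - z t - τ * z'| ≤ τ * (B * τ ^ 2) := by
  have hunique : UniqueDiffOn ℝ (Icc t (t + τ)) := uniqueDiffOn_Icc (by linarith)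
  have hmid : t + τ / 2 ∈ Icc t (t + τ) := ⟨by linarith, by linarith⟩
  have hend : t + τ ∈ Icc t (t + τ) := ⟨by linarith, le_rfl⟩
  have hB : 0 ≤ B := hz.nonneg hmid
  set z₁ := iteratedDerivWithin 1 z (Icc t (t + τ)) t with hz₁
  set z₂ := iteratedDerivWithin 2 z (Icc t (t + τ)) t with hz₂
  have hvalue : |z (t + τ) - (z t + τ * z₁ + 1 / 2 * τ ^ 2 * z₂)| ≤ B * τ ^ 3 / 2 := by
    simpa [taylor_within_apply, Finset.sum_range_succ, -iteratedDerivWithin_one,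
      ← hz₁, ← hz₂, one_add_one_eq_two] using
      BoundedContDiffOn.abs_sub_taylorWithinEval_le (n := 2) hz hend
  have hderiv : |z' - (z₁ + τ / 2 * z₂)| ≤ B * (τ / 2) ^ 2 := by
    have htaylor := BoundedContDiffOn.abs_sub_taylorWithinEval_le (n := 1)
      (BoundedContDiffOn.derivWithin hunique hz) hmid
    simpa [taylor_within_apply, Finset.sum_range_succ, ← iteratedDerivWithin_succ',
      -iteratedDerivWithin_one, hz'.derivWithin (hunique _ hmid), ← hz₁, ← hz₂] using htaylor
  calc |z (t + τ) - z t - τ * z'|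
      = |z (t + τ) - (z t + τ * z₁ + 1 / 2 * τ ^ 2 * z₂) - τ * (z' - (z₁ + τ / 2 * z₂))| := by
        ring_nf
    _ ≤ |z (t + τ) - (z t + τ * z₁ + 1 / 2 * τ ^ 2 * z₂)| + τ * |z' - (z₁ + τ / 2 * z₂)| := by
        simpa only [abs_mul, abs_of_pos hτ] using abs_sub
          (z (t + τ) - (z t + τ * z₁ + 1 / 2 * τ ^ 2 * z₂)) (τ * (z' - (z₁ + τ / 2 * z₂)))
    _ ≤ B * τ ^ 3 / 2 + τ * (B * (τ / 2) ^ 2) := by gcongr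
    _ ≤ τ * (B * τ ^ 2) := by linarith [(by positivity : 0 ≤ B * τ ^ 3)]

lemma abs_average_sub_midpoint_le (hτ : 0 < τ) (hz : BoundedContDiffOn 2 B z (Icc t (t + τ))) :
    |1 / 2 * (z (t + τ) + z t) - z (t + τ / 2)| ≤ B * τ ^ 2 := by
  have hmid : t + τ / 2 ∈ Icc t (t + τ) := ⟨by linarith, by linarith⟩
  have hend : t + τ ∈ Icc t (t + τ) := ⟨by linarith, le_rfl⟩
  have hB : 0 ≤ B := hz.nonneg hmid
  set z₁ := derivWithin z (Icc t (t + τ)) t with hz₁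
  have htaylor {s : ℝ} (hs : s ∈ Icc t (t + τ)) :
      |z s - (z t + (s - t) * z₁)| ≤ B * (s - t) ^ 2 := by
    simpa [taylor_within_apply, Finset.sum_range_succ, ← hz₁] using
      BoundedContDiffOn.abs_sub_taylorWithinEval_le (n := 1) hz hs
  have hvalue_end := abs_le.1 (htaylor hend)
  have hvalue_mid := abs_le.1 (htaylor hmid)
  simp only [add_sub_cancel_left] at hvalue_end hvalue_mid
  have : 0 ≤ B * τ ^ 2 := by positivity
  rw [abs_le]
  constructor <;> linarith

end Midpoint

lemma discrete_gronwall_fin {N : ℕ} {e : Fin (N + 1) → ℝ} {K τ ρ T : ℝ} (hK : 0 ≤ K) (hτ : 0 ≤ τ)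
    (hρ : 0 ≤ ρ) (hT : N * τ ≤ T) (he : ∀ k, 0 ≤ e k) (he₀ : e 0 = 0)
    (hstep : ∀ k : Fin N, e k.succ ≤ (1 + τ * K) * e k.castSucc + τ * ρ) (k : Fin (N + 1)) :
    e k ≤ T * Real.exp (T * K) * ρ := by
  let E : ℕ → ℝ := fun n => if hn : n < N + 1 then e ⟨n, hn⟩ else 0
  have hE_eq {n : ℕ} (hn : n < N + 1) : E n = e ⟨n, hn⟩ := dif_pos hn
  have hE (n : ℕ) : 0 ≤ E n := by
    unfold E
    split_ifs
    exacts [he _, le_rfl]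
  have hEstep (n : ℕ) : E (n + 1) ≤ (1 + τ * K) * E n + τ * ρ := by
    by_cases hn : n < N
    · rw [hE_eq (Nat.succ_lt_succ hn), hE_eq (hn.trans (Nat.lt_succ_self N))]
      exact hstep ⟨n, hn⟩
    · have hzero : E (n + 1) = 0 := by simp [E, hn]
      have hEn := hE n
      rw [hzero]
      positivity
  have hkT : (k : ℕ) * τ ≤ T :=
    (mul_le_mul_of_nonneg_right (by exact_mod_cast Nat.le_of_lt_succ k.2) hτ).trans hT
  have hT₀ : 0 ≤ T := (by positivity : (0 : ℝ) ≤ (k : ℕ) * τ).trans hkT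
  calc e k = E k := (hE_eq k.2).symm
    _ ≤ (k : ℕ) * τ * ρ * Real.exp ((k : ℕ) * τ * K) := by
        simpa [E, he₀, mul_assoc] using discrete_gronwall (c := fun _ => τ * K)
          (b := fun _ => τ * ρ) (hE 0) (fun n _ => hEstep n) (fun _ _ => mul_nonneg hτ hK)
          (fun _ _ => mul_nonneg hτ hρ) (Nat.zero_le k)
    _ ≤ T * ρ * Real.exp (T * K) := by gcongr
    _ = T * Real.exp (T * K) * ρ := by ring

-- `D` and `L` stand for the time derivative and the nonlocal term of the exact solution at the
-- midpoint in time, `G` for the boundary data.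
lemma norm_sub_le_of_crankNicolson_step {ι : Type*} [Fintype ι] [DecidableEq ι]
    {A : Matrix ι ι ℝ} {τ K ρ₁ ρ₂ ρ₃ : ℝ} (hτ : 0 ≤ τ) (hA : RowDominant A) (hK : 0 ≤ K)
    (hAK : ∀ i, A i i ≤ K) {U₀ U₁ v₀ v₁ vm D L G : ι → ℝ}
    (hU : (1 + (τ / 2) • A).mulVec U₁ = (1 - (τ / 2) • A).mulVec U₀ + τ • (D + L) + τ • G)
    (hderiv : ‖v₁ - v₀ - τ • D‖ ≤ τ * ρ₁) (haverage : ‖(1 / 2 : ℝ) • (v₁ + v₀) - vm‖ ≤ ρ₂)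
    (hspace : ‖A.mulVec vm - G - L‖ ≤ ρ₃) :
    ‖v₁ - U₁‖ ≤ (1 + τ * K) * ‖v₀ - U₀‖ + τ * (ρ₁ + 2 * K * ρ₂ + ρ₃) := by
  have herror : (1 + (τ / 2) • A).mulVec (v₁ - U₁) =
      (v₀ - U₀) - (τ / 2) • A.mulVec (v₀ - U₀) + (v₁ - v₀ - τ • D) +
        τ • A.mulVec ((1 / 2 : ℝ) • (v₁ + v₀) - vm) + τ • (A.mulVec vm - G - L) := by
    rw [Matrix.mulVec_sub, hU]
    simp only [Matrix.add_mulVec, Matrix.sub_mulVec, Matrix.one_mulVec, Matrix.smul_mulVec,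
      Matrix.mulVec_sub, Matrix.mulVec_smul, Matrix.mulVec_add]
    module
  have hτ₂ : 0 ≤ τ / 2 := by positivity
  calc ‖v₁ - U₁‖ ≤ ‖(1 + (τ / 2) • A).mulVec (v₁ - U₁)‖ :=
        hA.norm_le_norm_one_add_smul_mulVec hτ₂ _
    _ ≤ ‖v₀ - U₀‖ + ‖(τ / 2) • A.mulVec (v₀ - U₀)‖ + ‖v₁ - v₀ - τ • D‖ +
        ‖τ • A.mulVec ((1 / 2 : ℝ) • (v₁ + v₀) - vm)‖ + ‖τ • (A.mulVec vm - G - L)‖ := by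
        rw [herror]
        refine norm_add₄_le.trans ?_
        gcongr
        exact norm_sub_le _ _
    _ ≤ ‖v₀ - U₀‖ + τ / 2 * (2 * K * ‖v₀ - U₀‖) + τ * ρ₁ + τ * (2 * K * ρ₂) + τ * ρ₃ := by
        simp only [norm_smul τ, norm_smul (τ / 2), Real.norm_of_nonneg hτ,
          Real.norm_of_nonneg hτ₂]
        gcongr
        · exact hA.norm_mulVec_le hK hAK _
        · exact (hA.norm_mulVec_le hK hAK _).trans (by gcongr)
    _ = (1 + τ * K) * ‖v₀ - U₀‖ + τ * (ρ₁ + 2 * K * ρ₂ + ρ₃) := by ring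

lemma norm_sample_le {a b c d C : ℝ} {Mx My : ℕ} {w : ℝ → ℝ → ℝ} (hab : a < b) (hcd : c < d)
    (hMx : 1 ≤ Mx) (hMy : 1 ≤ My) (hw : ∀ x ∈ Ioo a b, ∀ y ∈ Ioo c d, |w x y| ≤ C) :
    ‖sample a b c d Mx My w‖ ≤ C := by
  have : Nonempty (Grid Mx My) := ⟨⟨⟨0, by omega⟩, ⟨0, by omega⟩⟩⟩
  exact (pi_norm_le_iff_of_nonempty _).2 fun p =>
    hw _ (halfNode_succ_mem_Ioo hab hMx p.1) _ (halfNode_succ_mem_Ioo hcd hMy p.2)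

lemma norm_sample_sub_sub_smul_deriv_le {a b c d t τ B : ℝ} {Mx My : ℕ} {u : ℝ → ℝ → ℝ → ℝ}
    {u' : ℝ → ℝ → ℝ} (hab : a < b) (hcd : c < d) (hMx : 1 ≤ Mx) (hMy : 1 ≤ My) (hτ : 0 < τ)
    (hu : ∀ x ∈ Ioo a b, ∀ y ∈ Ioo c d, BoundedContDiffOn 3 B (u x y) (Icc t (t + τ)))
    (hu' : ∀ x ∈ Ioo a b, ∀ y ∈ Ioo c d,
      HasDerivWithinAt (u x y) (u' x y) (Icc t (t + τ)) (t + τ / 2)) :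
    ‖sample a b c d Mx My (fun x y => u x y (t + τ)) - sample a b c d Mx My (fun x y => u x y t) -
      τ • sample a b c d Mx My u'‖ ≤ τ * (B * τ ^ 2) :=
  norm_sample_le (w := fun x y => u x y (t + τ) - u x y t - τ * u' x y) hab hcd hMx hMy
    fun x hx y hy => abs_sub_sub_mul_deriv_midpoint_le hτ (hu x hx y hy) (hu' x hx y hy)

lemma norm_sample_average_sub_midpoint_le {a b c d t τ B : ℝ} {Mx My : ℕ} {u : ℝ → ℝ → ℝ → ℝ}
    (hab : a < b) (hcd : c < d) (hMx : 1 ≤ Mx) (hMy : 1 ≤ My) (hτ : 0 < τ)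
    (hu : ∀ x ∈ Ioo a b, ∀ y ∈ Ioo c d, BoundedContDiffOn 2 B (u x y) (Icc t (t + τ))) :
    ‖(1 / 2 : ℝ) • (sample a b c d Mx My (fun x y => u x y (t + τ)) +
        sample a b c d Mx My fun x y => u x y t) -
      sample a b c d Mx My fun x y => u x y (t + τ / 2)‖ ≤ B * τ ^ 2 :=
  norm_sample_le (w := fun x y => 1 / 2 * (u x y (t + τ) + u x y t) - u x y (t + τ / 2)) hab hcd
    hMx hMy fun x hx y hy => abs_average_sub_midpoint_le hτ (hu x hx y hy)

section ErrorBound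

variable {a b c d T γ Bs Bt τ : ℝ} {f g : ℝ → ℝ → ℝ → ℝ} {u₀ : ℝ → ℝ → ℝ} {u : ℝ → ℝ → ℝ → ℝ}
  {Mx My N : ℕ}

/-- The factor by which the consistency error of the scheme exceeds `τ² + h_x^{4-γ} + h_y^{4-γ}`,
for bounds `Bs` and `Bt` on the space and time derivatives of the solution. -/
noncomputable def consistencyConst (a b c d γ Bs Bt : ℝ) : ℝ :=
  (1 + 2 * (kernBound a b γ * kernBound c d γ)) * Bt + spaceConst a b c d γ * Bs

lemma consistencyConst_nonneg (hab : a ≤ b) (hcd : c ≤ d) (hγ₁ : γ < 1) (hBs : 0 ≤ Bs)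
    (hBt : 0 ≤ Bt) : 0 ≤ consistencyConst a b c d γ Bs Bt := by
  have hKx := kernBound_nonneg hab hγ₁
  have hKy := kernBound_nonneg hcd hγ₁
  have hspace := spaceConst_nonneg hab hcd hγ₁
  unfold consistencyConst
  positivity

lemma consistency_errors_le {r s : ℝ} (hab : a ≤ b) (hcd : c ≤ d) (hγ₁ : γ < 1) (hBs : 0 ≤ Bs)
    (hBt : 0 ≤ Bt) (hr : 0 ≤ r) (hs : 0 ≤ s) :
    Bt * r + 2 * (kernBound a b γ * kernBound c d γ) * (Bt * r) + spaceConst a b c d γ * Bs * s ≤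
      consistencyConst a b c d γ Bs Bt * (r + s) := by
  have hKx := kernBound_nonneg hab hγ₁
  have hKy := kernBound_nonneg hcd hγ₁
  have hspace := spaceConst_nonneg hab hcd hγ₁
  have hcross : 0 ≤ (1 + 2 * (kernBound a b γ * kernBound c d γ)) * Bt * s +
      spaceConst a b c d γ * Bs * r := by positivity
  unfold consistencyConst
  linarith

lemma norm_sample_sub_succ_le (hab : a < b) (hcd : c < d) (hγ₀ : 0 ≤ γ) (hγ₁ : γ < 1)
    (hMx : 1 ≤ Mx) (hMy : 1 ≤ My) (hτ : 0 < τ) {t : ℝ} (ht : 0 ≤ t) (htT : t + τ ≤ T)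
    (hsol : IsExactSolution a b c d T γ f g u₀ u)
    (hspace : IsSlicewiseC4 a b c d Bs fun x y => u x y (t + τ / 2))
    (htime : ∀ x ∈ Icc a b, ∀ y ∈ Icc c d, BoundedContDiffOn 3 Bt (u x y) (Icc 0 T))
    {U₀ U₁ : Grid Mx My → ℝ}
    (hU : (1 + (τ / 2) • matA a b c d γ Mx My).mulVec U₁ =
      (1 - (τ / 2) • matA a b c d γ Mx My).mulVec U₀
        + τ • sample a b c d Mx My (fun x y => f x y (t + τ / 2))
        + τ • bdryVec a b c d γ Mx My (fun x y => g x y (t + τ / 2))) :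
    ‖sample a b c d Mx My (fun x y => u x y (t + τ)) - U₁‖ ≤
      (1 + τ * (kernBound a b γ * kernBound c d γ)) *
          ‖sample a b c d Mx My (fun x y => u x y t) - U₀‖ +
        τ * (consistencyConst a b c d γ Bs Bt *
          (τ ^ 2 + step a b Mx ^ (4 - γ) + step c d My ^ (4 - γ))) := by
  obtain ⟨hpde, hboundary, -⟩ := hsol
  have hKx := kernBound_nonneg hab.le hγ₁
  have hKy := kernBound_nonneg hcd.le hγ₁
  have hmid : t + τ / 2 ∈ Ioc 0 T := ⟨by linarith, by linarith⟩
  have hsub : Icc t (t + τ) ⊆ Icc 0 T := Icc_subset_Icc ht htT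
  have hlocal : ∀ x ∈ Ioo a b, ∀ y ∈ Ioo c d,
      BoundedContDiffOn 3 Bt (u x y) (Icc t (t + τ)) := fun x hx y hy =>
    (htime x (Ioo_subset_Icc_self hx) y (Ioo_subset_Icc_self hy)).mono_Icc (by linarith) hsub
  have hsource : sample a b c d Mx My (fun x y => f x y (t + τ / 2)) =
      sample a b c d Mx My (fun x y => f x y (t + τ / 2) -
        nonlocalOp a b c d γ (fun x' y' => u x' y' (t + τ / 2)) x y) +
      sample a b c d Mx My (nonlocalOp a b c d γ fun x y => u x y (t + τ / 2)) :=
    funext fun _ => (sub_add_cancel _ _).symm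
  rw [hsource, ← bdryVec_congr (v := fun x y => u x y (t + τ / 2)) hab hcd hMx hMy
    fun p hp => hboundary p hp _ hmid] at hU
  have hstep := norm_sub_le_of_crankNicolson_step hτ.le
    (rowDominant_matA hab hcd hγ₀ hγ₁ hMx hMy) (mul_nonneg hKx hKy)
    (matA_diag_le hab hcd hγ₀ hγ₁ hMx hMy) hU
    (norm_sample_sub_sub_smul_deriv_le hab hcd hMx hMy hτ hlocal
      fun x hx y hy => (hpde x hx y hy _ hmid).mono hsub)
    (norm_sample_average_sub_midpoint_le hab hcd hMx hMy hτ
      fun x hx y hy => (hlocal x hx y hy).of_le (by norm_num))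
    (norm_matA_mulVec_sample_sub_bdryVec_sub_nonlocalOp_le hab hcd hγ₀ hγ₁ hMx hMy hspace)
  rw [add_assoc (τ ^ 2)]
  refine hstep.trans (add_le_add_right (mul_le_mul_of_nonneg_left (consistency_errors_le hab.le
    hcd.le hγ₁ (hspace.nonneg hab.le hcd.le) ?_ (sq_nonneg τ) ?_) hτ.le) _)
  · exact (htime a (left_mem_Icc.2 hab.le) c (left_mem_Icc.2 hcd.le)).nonneg
      (Ioc_subset_Icc_self hmid)
  · exact add_nonneg (Real.rpow_nonneg (step_pos hab hMx).le _)
      (Real.rpow_nonneg (step_pos hcd hMy).le _)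

lemma sample_zero_eq (hab : a < b) (hcd : c < d) (hMx : 1 ≤ Mx) (hMy : 1 ≤ My)
    (hsol : IsExactSolution a b c d T γ f g u₀ u) :
    sample a b c d Mx My (fun x y => u x y 0) = sample a b c d Mx My u₀ :=
  funext fun p => hsol.2.2 _ (halfNode_succ_mem_Ioo hab hMx p.1) _
    (halfNode_succ_mem_Ioo hcd hMy p.2)

theorem norm_sample_sub_isSchemeSolution_le (hab : a < b) (hcd : c < d) (hT : 0 < T) (hγ₀ : 0 ≤ γ)
    (hγ₁ : γ < 1) (hMx : 1 ≤ Mx) (hMy : 1 ≤ My) (hτ : 0 < τ) (hN : N * τ ≤ T)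
    (hsol : IsExactSolution a b c d T γ f g u₀ u)
    (hspace : ∀ t ∈ Ioc 0 T, IsSlicewiseC4 a b c d Bs fun x y => u x y t)
    (htime : ∀ x ∈ Icc a b, ∀ y ∈ Icc c d, BoundedContDiffOn 3 Bt (u x y) (Icc 0 T))
    {U : Fin (N + 1) → Grid Mx My → ℝ} (hU : IsSchemeSolution a b c d γ τ Mx My N f g u₀ U)
    (k : Fin (N + 1)) :
    ‖sample a b c d Mx My (fun x y => u x y ((k : ℕ) * τ)) - U k‖ ≤
      T * Real.exp (T * (kernBound a b γ * kernBound c d γ)) *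
        (consistencyConst a b c d γ Bs Bt *
          (τ ^ 2 + step a b Mx ^ (4 - γ) + step c d My ^ (4 - γ))) := by
  have hBs : 0 ≤ Bs := (hspace T (right_mem_Ioc.2 hT)).nonneg hab.le hcd.le
  have hBt : 0 ≤ Bt := (htime a (left_mem_Icc.2 hab.le) c (left_mem_Icc.2 hcd.le)).nonneg
    (left_mem_Icc.2 hT.le)
  have hρ : 0 ≤ consistencyConst a b c d γ Bs Bt *
      (τ ^ 2 + step a b Mx ^ (4 - γ) + step c d My ^ (4 - γ)) :=
    mul_nonneg (consistencyConst_nonneg hab.le hcd.le hγ₁ hBs hBt)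
      (add_nonneg (add_nonneg (sq_nonneg τ) (Real.rpow_nonneg (step_pos hab hMx).le _))
        (Real.rpow_nonneg (step_pos hcd hMy).le _))
  refine discrete_gronwall_fin
    (e := fun k => ‖sample a b c d Mx My (fun x y => u x y ((k : ℕ) * τ)) - U k‖)
    (mul_nonneg (kernBound_nonneg hab.le hγ₁) (kernBound_nonneg hcd.le hγ₁)) hτ.le hρ hN
    (fun _ => norm_nonneg _) ?_ (fun k => ?_) k
  · simp [hU.1, sample_zero_eq hab hcd hMx hMy hsol]
  · have hkT : (k : ℕ) * τ + τ ≤ T := by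
      rw [← add_one_mul]
      exact (mul_le_mul_of_nonneg_right (by exact_mod_cast k.2) hτ.le).trans hN
    have hmid : ((k : ℕ) + 1 / 2 : ℝ) * τ = (k : ℕ) * τ + τ / 2 := by ring
    have hUk := hU.2 k
    rw [hmid] at hUk
    simpa only [Fin.val_succ, Fin.val_castSucc, Nat.cast_add_one, add_one_mul] using
      norm_sample_sub_succ_le hab hcd hγ₀ hγ₁ hMx hMy hτ (by positivity) hkT hsol
        (hspace _ ⟨by positivity, by linarith⟩) htime hUk

end ErrorBound

lemma IsSmooth.exists_isSlicewiseC4 {a b c d T : ℝ} {u : ℝ → ℝ → ℝ → ℝ} (hab : a < b)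
    (hcd : c < d) (hu : IsSmooth a b c d T u) :
    ∃ B, ∀ t ∈ Icc 0 T, IsSlicewiseC4 a b c d B fun x y => u x y t := by
  obtain ⟨hC6, ⟨B, hB⟩, -, -⟩ := hu
  refine ⟨Nat.factorial 4 * B, fun t ht => ?_⟩
  have hC4 : ContDiffOn ℝ 4 (fun p : ℝ × ℝ => u p.1 p.2 t) (Icc a b ×ˢ Icc c d) :=
    (hC6 t ht).of_le (by norm_num)
  exact isSlicewiseC4_of_contDiffOn hab hcd hC4 fun p hp m hm => hB t ht p hp m (by omega)

lemma IsSmooth.exists_boundedContDiffOn {a b c d T : ℝ} {u : ℝ → ℝ → ℝ → ℝ}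
    (hu : IsSmooth a b c d T u) :
    ∃ B, ∀ x ∈ Icc a b, ∀ y ∈ Icc c d, BoundedContDiffOn 3 B (u x y) (Icc 0 T) := by
  obtain ⟨-, -, hC3, B, hB⟩ := hu
  exact ⟨B, fun x hx y hy => ⟨hC3 (x, y) ⟨hx, hy⟩, hB (x, y) ⟨hx, hy⟩⟩⟩

end NonlocalCN

open NonlocalCN in
theorem theorem3p11_general (a b c d T γ : ℝ) (hab : a < b) (hcd : c < d) (hT : 0 < T)
    (hγ₀ : 0 ≤ γ) (hγ₁ : γ < 1)
    (f g : ℝ → ℝ → ℝ → ℝ) (u₀ : ℝ → ℝ → ℝ) (u : ℝ → ℝ → ℝ → ℝ)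
    (hsol : IsExactSolution a b c d T γ f g u₀ u)
    (hspace : ∃ B, ∀ t ∈ Ioc 0 T, IsSlicewiseC4 a b c d B fun x y => u x y t)
    (htime : ∃ B, ∀ x ∈ Icc a b, ∀ y ∈ Icc c d, BoundedContDiffOn 3 B (u x y) (Icc 0 T)) :
    ∃ C : ℝ, ∀ (Mx My N : ℕ) (τ : ℝ), 1 ≤ Mx → 1 ≤ My → 0 < τ → (N : ℝ) * τ ≤ T →
      (∃! U : Fin (N + 1) → Grid Mx My → ℝ, IsSchemeSolution a b c d γ τ Mx My N f g u₀ U) ∧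
      ∀ U : Fin (N + 1) → Grid Mx My → ℝ, IsSchemeSolution a b c d γ τ Mx My N f g u₀ U →
        ∀ k : Fin (N + 1),
          ‖sample a b c d Mx My (fun x y => u x y (((k : ℕ) : ℝ) * τ)) - U k‖ ≤
            C * (τ ^ 2 + step a b Mx ^ (4 - γ) + step c d My ^ (4 - γ)) := by
  obtain ⟨Bs, hspace⟩ := hspace
  obtain ⟨Bt, htime⟩ := htime
  refine ⟨T * Real.exp (T * (kernBound a b γ * kernBound c d γ)) *
    consistencyConst a b c d γ Bs Bt, fun Mx My N τ hMx hMy hτ hN =>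
      ⟨existsUnique_isSchemeSolution hab hcd hγ₀ hγ₁ hMx hMy hτ.le N f g u₀, fun U hU k => ?_⟩⟩
  rw [mul_assoc]
  exact norm_sample_sub_isSchemeSolution_le hab hcd hT hγ₀ hγ₁ hMx hMy hτ hN hsol hspace htime hU k

/-- The norm on `Grid Mx My → ℝ` is the maximum norm. -/
theorem theorem3p11 (a b c d T γ : ℝ) (hab : a < b) (hcd : c < d) (hT : 0 < T)
    (hγ₀ : 0 < γ) (hγ₁ : γ < 1)
    (f g : ℝ → ℝ → ℝ → ℝ) (u₀ : ℝ → ℝ → ℝ) (u : ℝ → ℝ → ℝ → ℝ)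
    (hsol : NonlocalCN.IsExactSolution a b c d T γ f g u₀ u)
    (hsmooth : NonlocalCN.IsSmooth a b c d T u) :
    ∃ C : ℝ, ∀ (Mx My N : ℕ) (τ : ℝ), 1 ≤ Mx → 1 ≤ My → 0 < τ → (N : ℝ) * τ ≤ T →
      (∃! U : Fin (N + 1) → NonlocalCN.Grid Mx My → ℝ,
        NonlocalCN.IsSchemeSolution a b c d γ τ Mx My N f g u₀ U) ∧
      ∀ U : Fin (N + 1) → NonlocalCN.Grid Mx My → ℝ,
        NonlocalCN.IsSchemeSolution a b c d γ τ Mx My N f g u₀ U →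
        ∀ k : Fin (N + 1),
          ‖NonlocalCN.sample a b c d Mx My (fun x y => u x y (((k : ℕ) : ℝ) * τ)) - U k‖ ≤
            C * (τ ^ 2 + NonlocalCN.step a b Mx ^ (4 - γ) + NonlocalCN.step c d My ^ (4 - γ)) := by
  obtain ⟨Bs, hspace⟩ := hsmooth.exists_isSlicewiseC4 hab hcd
  exact theorem3p11_general a b c d T γ hab hcd hT hγ₀.le hγ₁ f g u₀ u hsol
    ⟨Bs, fun t ht => hspace t (Ioc_subset_Icc_self ht)⟩ hsmooth.exists_boundedContDiffOn
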